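/- Let $\rho>0$. Consider the M/M/1 processor-sharing queue with service rate $1$, arrival rate $\rho$ and non-balking probabilities $b_n=\frac1{n+1}$. Let $\mathcal V_n$ be the sojourn time of a tagged customer who joins when $n\ge 0$ other customers are present; that is, $\mathcal V_n$ is the absorption time of the continuous-time Markov chain started at $n$ (the number of other customers present) which jumps from state $k$ to $k-1$ at rate $\frac{k}{k+1}$, to $k+1$ at rate $\rho\, b_k=\frac{\rho}{k+1}$, and is absorbed (the tagged customer leaves) at rate $\frac1{k+1}$. Let $\mathbf V_n(t)=\mathrm{Prob}[\mathcal V_n>t]$, let $p_n(t)=-\mathbf V_n'(t)$ for $t\ge 0$ (right derivative at $t=0$) be the conditional sojourn-time density, and let $$p_{PS}(t)=\sum_{n=0}^\infty \frac{\rho^n}{n!}\,e^{-\rho}\,p_n(t)$$ be the unconditional sojourn-time density. For $m\ge 1$ put $$\nu_m=-1+\frac1{2m}\Big[-\rho+\sqrt{\rho^2+4m\rho}\Big],\qquad \widetilde\nu_m=-1+\frac1{2m}\Big[-\rho-\sqrt{\rho^2+4m\rho}\Big],$$ $$C_m(\nu)=\frac{m^{m-1}}{m!}\,\frac{\nu}{\nu-1}\,e^{-m},\qquad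 \Phi_m(\nu)=e^{-\rho}(-\nu)^{m-1}\exp\Big(\frac{\rho}{\nu+1}\Big).$$ Theorem 2.6. Each $\mathbf V_n$ is differentiable on $[0,\infty)$ (one-sidedly at $0$), and for every $t\ge 0$ the series defining $p_{PS}(t)$ and both series below converge absolutely, with $$p_{PS}(t)=\sum_{m=1}^\infty C_m(\nu_m)\,\Phi_m(\nu_m)\,e^{\nu_m t}+\sum_{m=1}^\infty C_m(\widetilde\nu_m)\,\Phi_m(\widetilde\nu_m)\,e^{\widetilde\nu_m t}.$$ -/

import Mathlib

open MeasureTheory ProbabilityTheory Set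
open scoped ENNReal

noncomputable section

namespace BalkingPS

/-- The non-balking probability `b_n = 1 / (n + 1)`. -/
def joinProb (n : ℕ) : ℝ := 1 / ((n : ℝ) + 1)

/-- Total event rate while the tagged customer is present together with `n` other customers:
service completions occur at rate `1`, joining arrivals at rate `ρ * b_n`. -/
def totalRate (ρ : ℝ) (n : ℕ) : ℝ := 1 + ρ * joinProb n

/-- One jump of the Markov chain "number of other customers present while the tagged customer is
in the system"; `none` means that the tagged customer has left. The jump is driven by a uniform
variable `u`. From `n` it goes
* to `none`, at rate `1 / (n + 1)` (under processor sharing a service completion is that of each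
  of the `n + 1` customers present with equal probability),
* to `n - 1`, at rate `n / (n + 1)`,
* to `n + 1`, at rate `ρ * b_n`. -/
def jump (ρ : ℝ) (u : ℝ) : Option ℕ → Option ℕ
  | none => none
  | some n =>
      if totalRate ρ n * u < 1 / ((n : ℝ) + 1) then none
      else if totalRate ρ n * u < 1 then some (n - 1)
      else some (n + 1)

/-- The random input: at each step a pair consisting of a standard exponential variable (for the
holding time) and a uniform variable on `[0, 1]` (for the jump). -/
abbrev Input : Type := ℕ → ℝ × unitInterval

/-- The law of the input: all coordinates are independent. -/
def inputLaw : Measure Input :=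
  Measure.infinitePi fun _ : ℕ => (expMeasure 1).prod (volume : Measure unitInterval)

instance : IsProbabilityMeasure inputLaw := by
  have : IsProbabilityMeasure (expMeasure 1) := isProbabilityMeasure_expMeasure one_pos
  unfold inputLaw
  infer_instance

/-- The embedded jump chain, started when the tagged customer joins `n` others. -/
def chain (ρ : ℝ) (n : ℕ) (ω : Input) : ℕ → Option ℕ
  | 0 => some n
  | k + 1 => jump ρ ((ω k).2 : ℝ) (chain ρ n ω k)

/-- The time spent in a state: in state `n` it is exponential with rate `totalRate ρ n`; no time
is counted after the tagged customer has left. -/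
def holdingTime (ρ : ℝ) (e : ℝ) : Option ℕ → ℝ≥0∞
  | none => 0
  | some n => ENNReal.ofReal (e / totalRate ρ n)

/-- The sojourn time `𝒱_n` of a tagged customer that finds `n` others in the system. -/
def sojournTime (ρ : ℝ) (n : ℕ) (ω : Input) : ℝ≥0∞ :=
  ∑' k : ℕ, holdingTime ρ (ω k).1 (chain ρ n ω k)

/-- The tail probability `V_n(t) = Prob[𝒱_n > t]`. -/
def survival (ρ : ℝ) (n : ℕ) (t : ℝ) : ℝ :=
  inputLaw.real {ω | ENNReal.ofReal t < sojournTime ρ n ω}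

/-- The conditional sojourn time density `p_n(t) = -V_n'(t)`, `t ≥ 0`
(the right derivative is used at `t = 0`). -/
def condDensity (ρ : ℝ) (n : ℕ) (t : ℝ) : ℝ :=
  -derivWithin (survival ρ n) (Ici 0) t

/-- The `n`-th term `(ρ ^ n / n!) e^{-ρ} p_n(t)` of the Poisson mixture. -/
def mixTerm (ρ t : ℝ) (n : ℕ) : ℝ :=
  ρ ^ n / (n.factorial : ℝ) * Real.exp (-ρ) * condDensity ρ n t

/-- The unconditional sojourn time density `p_PS(t) = ∑_{n ≥ 0} (ρ ^ n / n!) e^{-ρ} p_n(t)`. -/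
def uncondDensity (ρ t : ℝ) : ℝ := ∑' n : ℕ, mixTerm ρ t n

/-- The eigenvalue `ν_m`, `m ≥ 1`. -/
def eigPlus (ρ : ℝ) (m : ℕ) : ℝ :=
  -1 + 1 / (2 * (m : ℝ)) * (-ρ + Real.sqrt (ρ ^ 2 + 4 * (m : ℝ) * ρ))

/-- The eigenvalue `ν̃_m`, `m ≥ 1`. -/
def eigMinus (ρ : ℝ) (m : ℕ) : ℝ :=
  -1 + 1 / (2 * (m : ℝ)) * (-ρ - Real.sqrt (ρ ^ 2 + 4 * (m : ℝ) * ρ))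

/-- The coefficient `C_m(ν)`, `m ≥ 1`. -/
def coeffC (m : ℕ) (ν : ℝ) : ℝ :=
  (m : ℝ) ^ (m - 1) / (m.factorial : ℝ) * (ν / (ν - 1)) * Real.exp (-(m : ℝ))

/-- `Φ_m(ν) = e^{-ρ} (-ν)^{m-1} exp (ρ / (ν + 1))`, `m ≥ 1`. -/
def bigPhi (ρ : ℝ) (m : ℕ) (ν : ℝ) : ℝ :=
  Real.exp (-ρ) * (-ν) ^ (m - 1) * Real.exp (ρ / (ν + 1))

/-- The contribution `C_m(ν) Φ_m(ν) e^{ν t}` of the eigenvalue `ν` to the spectral expansion. -/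
def spectralTerm (ρ t : ℝ) (m : ℕ) (ν : ℝ) : ℝ :=
  coeffC m ν * bigPhi ρ m ν * Real.exp (ν * t)

end BalkingPS

end

/-!
The tail probabilities satisfy the backward equation `V' = A V`, `V(0) = 1`, of the killed chain;
it is obtained by conditioning on the first jump, that is, by splitting off the first coordinate of
the random input (`survival_integral_equation`, `hasDerivWithinAt_survival`). The generator `A` is
symmetric for the weight `w n = (n + 1) ρ ^ n / n!`, and with `g n = 1 / (n + 1) = p_n(0)` the
density to be computed is `e^{-ρ} ⟨g, p(t)⟩_w`. The theorem is Parseval's identity for this inner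
product in a basis of eigenvectors of `A`, once the basis is shown to be complete.

*Completeness.* Conjugated by `√w`, the operator `A + 1` becomes a Jacobi operator on `ℓ²` whose
entries tend to zero, so it is compact and self-adjoint, and its eigenspaces span a dense subspace
by the spectral theorem. It remains to find the square-summable solutions of `(A + 1) f = s f`. For
`s ≠ 0` put `a = ρ / s²`; then `b n = s ^ n f n` is an eigenfunction, with eigenvalue
`κ = a - 1 - ρ / s`, of the number operator built from the ladder operators `lower` and `raise`,
which are adjoint up to sign for the weight `a ^ n / n!`. As for the harmonic oscillator, `κ ≥ 0`
and lowering decreases `κ` by one, hence `κ` is a natural number `m - 1`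
(`IsNumberEigen.exists_nat`). This says `m s² + ρ s = ρ`, whose two roots are `1 + ν_m` and
`1 + ν̃_m`. The value `s = 0` is excluded by a commutator argument (`eq_zero_of_kernel`).

*Coefficients.* The eigenfunctions are `f n = s⁻ⁿ C_{m-1}(n; a)` with Charlier polynomials, whose
generating function and norms follow from the ladder operators (`tsum_charlier`,
`tsum_charlier_sq_weighted`). Pairing the backward equation with an eigenfunction gives a scalar
equation, so `⟨f, p(t)⟩_w = e^{ν t} ⟨f, g⟩_w` (`tsum_eigen_condDensity`), and the terms of the
Parseval sum are the terms of the spectral expansion (`hasSum_spectralTerm`).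
-/

open MeasureTheory ProbabilityTheory Set
open scoped ENNReal

noncomputable section

namespace BalkingPS

/-! ### First-step decomposition of the random input -/

/-- Put a fresh pair in front of an input sequence. -/
def consInput {α : Type*} (q : α × (ℕ → α)) : ℕ → α
  | 0 => q.1
  | k + 1 => q.2 k

@[simp] lemma consInput_zero {α : Type*} (q : α × (ℕ → α)) : consInput q 0 = q.1 := rfl

@[simp] lemma consInput_succ {α : Type*} (q : α × (ℕ → α)) (k : ℕ) :
    consInput q (k + 1) = q.2 k := rfl

lemma measurable_consInput {α : Type*} [MeasurableSpace α] :
    Measurable (consInput : α × (ℕ → α) → ℕ → α) := by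
  refine measurable_pi_lambda _ fun k => ?_
  cases k with
  | zero => exact measurable_fst
  | succ k => exact (measurable_pi_apply k).comp measurable_snd

/-- The law of an i.i.d. sequence is preserved when an independent copy of its first entry is put in
front. -/
lemma map_consInput_infinitePi {α : Type*} [MeasurableSpace α] (μ : Measure α)
    [IsProbabilityMeasure μ] :
    (μ.prod (Measure.infinitePi fun _ : ℕ => μ)).map consInput =
      Measure.infinitePi fun _ : ℕ => μ := by
  classical
  refine Measure.eq_infinitePi _ fun s t ht => ?_
  obtain ⟨N, hN⟩ : ∃ N, s ⊆ Finset.range (N + 1) :=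
    ⟨s.sup id, fun i hi => Finset.mem_range_succ_iff.2 (Finset.le_sup (f := id) hi)⟩
  -- enlarge `s` to an initial segment, without constraints at the new indices
  let t' : ℕ → Set α := fun i => if i ∈ s then t i else univ
  have ht' : ∀ i, MeasurableSet (t' i) := fun i => by
    by_cases h : i ∈ s <;> simp [t', h, ht]
  have hpre : consInput ⁻¹' (Set.pi s t) =
      t' 0 ×ˢ Set.pi (Finset.range N : Set ℕ) (fun i => t' (i + 1)) := by
    ext ⟨p, ω⟩
    simp only [mem_preimage, Set.mem_pi, Finset.mem_coe, mem_prod, Finset.mem_range]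
    constructor
    · intro h
      refine ⟨?_, fun i _ => ?_⟩
      · by_cases h0 : 0 ∈ s
        · simpa [t', h0] using h 0 h0
        · simp [t', h0]
      · by_cases h0 : i + 1 ∈ s
        · simpa [t', h0] using h (i + 1) h0
        · simp [t', h0]
    · rintro ⟨h0, h1⟩ i hi
      cases i with
      | zero => simpa [t', hi] using h0
      | succ i =>
        have := h1 i (by have := Finset.mem_range.1 (hN hi); omega)
        simpa [t', hi] using this
  rw [Measure.map_apply measurable_consInput
    (MeasurableSet.pi s.countable_toSet fun i _ => ht i), hpre, Measure.prod_prod,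
    Measure.infinitePi_pi _ fun i _ => ht' (i + 1)]
  have hprod : ∏ i ∈ s, μ (t i) = ∏ i ∈ Finset.range (N + 1), μ (t' i) := by
    rw [← Finset.prod_subset hN]
    · exact Finset.prod_congr rfl fun i hi => by simp [t', hi]
    · intro i _ hi
      simp [t', hi]
  rw [hprod, Finset.prod_range_succ', mul_comm]

/-- The chain `chain ρ n` with an arbitrary initial state, the cemetery `none` included. -/
def chainFrom (ρ : ℝ) (x : Option ℕ) (ω : Input) : ℕ → Option ℕ
  | 0 => x
  | k + 1 => jump ρ ((ω k).2 : ℝ) (chainFrom ρ x ω k)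

/-- The time to absorption of the chain started in an arbitrary state. -/
def absorptionTime (ρ : ℝ) (x : Option ℕ) (ω : Input) : ℝ≥0∞ :=
  ∑' k : ℕ, holdingTime ρ (ω k).1 (chainFrom ρ x ω k)

lemma chainFrom_some (ρ : ℝ) (n : ℕ) (ω : Input) (k : ℕ) :
    chainFrom ρ (some n) ω k = chain ρ n ω k := by
  induction k with
  | zero => rfl
  | succ k ih => simp only [chainFrom, chain, ih]

lemma absorptionTime_some (ρ : ℝ) (n : ℕ) (ω : Input) :
    absorptionTime ρ (some n) ω = sojournTime ρ n ω := by
  simp only [absorptionTime, sojournTime, chainFrom_some]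

lemma chainFrom_none (ρ : ℝ) (ω : Input) (k : ℕ) : chainFrom ρ none ω k = none := by
  induction k with
  | zero => rfl
  | succ k ih => simp only [chainFrom, ih, jump]

lemma absorptionTime_none (ρ : ℝ) (ω : Input) : absorptionTime ρ none ω = 0 := by
  simp [absorptionTime, chainFrom_none, holdingTime]

lemma chainFrom_consInput (ρ : ℝ) (x : Option ℕ) (p : ℝ × unitInterval) (ω : Input) (k : ℕ) :
    chainFrom ρ x (consInput (p, ω)) (k + 1) = chainFrom ρ (jump ρ p.2 x) ω k := by
  induction k with
  | zero => rfl
  | succ k ih => rw [chainFrom, ih]; rfl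

/-- First-step decomposition of the absorption time. -/
lemma absorptionTime_consInput (ρ : ℝ) (x : Option ℕ) (p : ℝ × unitInterval) (ω : Input) :
    absorptionTime ρ x (consInput (p, ω)) =
      holdingTime ρ p.1 x + absorptionTime ρ (jump ρ p.2 x) ω := by
  rw [absorptionTime, tsum_eq_zero_add' ENNReal.summable]
  simp only [chainFrom_consInput]
  rfl

section Measurability

/-- The discrete structure on the state space; it is only used to prove measurability. -/
local instance instMeasurableSpaceOptionNat : MeasurableSpace (Option ℕ) := ⊤

lemma measurable_jump (ρ : ℝ) (x : Option ℕ) : Measurable fun u : ℝ => jump ρ u x := by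
  cases x with
  | none => exact measurable_const
  | some n =>
    unfold jump
    refine Measurable.ite (measurableSet_lt (by fun_prop) (by fun_prop)) measurable_const ?_
    exact Measurable.ite (measurableSet_lt (by fun_prop) (by fun_prop)) measurable_const
      measurable_const

lemma measurable_chainFrom (ρ : ℝ) (x : Option ℕ) (k : ℕ) :
    Measurable fun ω : Input => chainFrom ρ x ω k := by
  induction k with
  | zero => exact measurable_const
  | succ k ih =>
    have h : Measurable fun q : ℝ × Option ℕ => jump ρ q.1 q.2 :=
      measurable_from_prod_countable_left fun y => measurable_jump ρ y
    have h2 : Measurable fun ω : Input => ((ω k).2 : ℝ) :=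
      measurable_subtype_coe.comp (measurable_snd.comp (measurable_pi_apply k))
    exact h.comp (h2.prodMk ih)

lemma measurable_absorptionTime (ρ : ℝ) (x : Option ℕ) : Measurable (absorptionTime ρ x) := by
  refine Measurable.tsum fun k => ?_
  have h : Measurable fun q : ℝ × Option ℕ => holdingTime ρ q.1 q.2 := by
    refine measurable_from_prod_countable_left fun y => ?_
    cases y with
    | none => exact measurable_const
    | some n => exact ENNReal.measurable_ofReal.comp (measurable_id.div_const _)
  exact h.comp ((measurable_fst.comp (measurable_pi_apply k)).prodMk (measurable_chainFrom ρ x k))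

end Measurability

lemma totalRate_pos {ρ : ℝ} (hρ : 0 < ρ) (n : ℕ) : 0 < totalRate ρ n := by
  unfold totalRate joinProb; positivity

/-- Averaging a function of the state over one jump. -/
lemma integral_jump {ρ : ℝ} (hρ : 0 < ρ) (n : ℕ) (H : Option ℕ → ℝ) :
    ∫ u : unitInterval, H (jump ρ u (some n)) =
      (1 / ((n : ℝ) + 1) * H none + (n : ℝ) / (n + 1) * H (some (n - 1))
        + ρ / (n + 1) * H (some (n + 1))) / totalRate ρ n := by
  have hl := totalRate_pos hρ n
  have hn : (0 : ℝ) < (n : ℝ) + 1 := by positivity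
  set l := totalRate ρ n with hl'
  have hl1 : l = 1 + ρ / (n + 1) := by rw [hl', totalRate, joinProb]; ring
  set c : ℝ := 1 / ((n : ℝ) + 1) / l
  set d : ℝ := 1 / l
  have hc0 : 0 ≤ c := by positivity
  have hcd : c ≤ d := by
    apply div_le_div_of_nonneg_right _ hl.le
    rw [div_le_one hn]; linarith [(Nat.cast_nonneg n : (0 : ℝ) ≤ n)]
  have hd1 : d ≤ 1 := by
    rw [div_le_one hl, hl1]
    have : 0 < ρ / ((n : ℝ) + 1) := by positivity
    linarith
  let C : unitInterval := ⟨c, hc0, hcd.trans hd1⟩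
  let E : unitInterval := ⟨d, hc0.trans hcd, hd1⟩
  have hfun : ∀ u : unitInterval, H (jump ρ u (some n)) =
      (Iio C).indicator (fun _ => H none - H (some (n - 1))) u
        + (Iio E).indicator (fun _ => H (some (n - 1)) - H (some (n + 1))) u
        + H (some (n + 1)) := by
    intro u
    have h1 : l * (u : ℝ) < 1 / ((n : ℝ) + 1) ↔ u < C := by
      rw [← Subtype.coe_lt_coe, lt_div_iff₀ hl, mul_comm]
    have h2 : l * (u : ℝ) < 1 ↔ u < E := by
      rw [← Subtype.coe_lt_coe, lt_div_iff₀ hl, mul_comm]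
    have h3 : C ≤ E := hcd
    simp only [jump, ← hl', h1, h2, indicator, mem_Iio]
    split_ifs with h4 h5
    · ring
    · exact absurd (h4.trans_le h3) h5
    · ring
    · ring
  simp_rw [hfun]
  have i1 : Integrable (fun u : unitInterval =>
      (Iio C).indicator (fun _ => H none - H (some (n - 1))) u) :=
    (integrable_const _).indicator measurableSet_Iio
  have i2 : Integrable (fun u : unitInterval =>
      (Iio E).indicator (fun _ => H (some (n - 1)) - H (some (n + 1))) u) :=
    (integrable_const _).indicator measurableSet_Iio
  have e := integral_add (i1.add i2) (integrable_const (H (some (n + 1))))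
  simp only [Pi.add_apply] at e
  rw [e, integral_add i1 i2, integral_indicator_const _ measurableSet_Iio,
    integral_indicator_const _ measurableSet_Iio]
  simp only [measureReal_def, unitInterval.volume_Iio, integral_const, measure_univ,
    ENNReal.toReal_one, smul_eq_mul, one_mul]
  rw [ENNReal.toReal_ofReal hc0, ENNReal.toReal_ofReal (hc0.trans hcd)]
  change c * _ + d * _ + _ = _
  simp only [c, d]
  have : ρ = (l - 1) * (n + 1) := by rw [hl1]; field_simp; ring
  rw [this]
  field_simp
  ring

/-! ### The backward equation -/

lemma survival_eq_absorptionTime (ρ : ℝ) (n : ℕ) (t : ℝ) :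
    survival ρ n t = inputLaw.real {ω | ENNReal.ofReal t < absorptionTime ρ (some n) ω} := by
  simp only [survival, absorptionTime_some]

lemma survival_nonneg (ρ : ℝ) (n : ℕ) (t : ℝ) : 0 ≤ survival ρ n t := measureReal_nonneg

lemma survival_le_one (ρ : ℝ) (n : ℕ) (t : ℝ) : survival ρ n t ≤ 1 := measureReal_le_one

lemma abs_survival_le_one (ρ : ℝ) (n : ℕ) (t : ℝ) : |survival ρ n t| ≤ 1 := by
  rw [abs_of_nonneg (survival_nonneg ρ n t)]; exact survival_le_one ρ n t

lemma antitone_survival (ρ : ℝ) (n : ℕ) : Antitone (survival ρ n) := fun _ _ h =>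
  measureReal_mono fun _ hω => (ENNReal.ofReal_le_ofReal h).trans_lt hω

lemma survival_max_zero (ρ : ℝ) (n : ℕ) (t : ℝ) : survival ρ n (max t 0) = survival ρ n t := by
  have : ENNReal.ofReal (max t 0) = ENNReal.ofReal t := by
    rcases le_total t 0 with h | h
    · simp [h, ENNReal.ofReal_of_nonpos h]
    · simp [h]
  simp only [survival, this]

/-- The inflow term of the backward equation: the rates of the jumps from `n` to other transient
states, paired with the values of `f` there. For `n = 0` the junk value `0 - 1 = 0` is harmless,
because its rate is zero. -/
def inflow (ρ : ℝ) (f : ℕ → ℝ) (n : ℕ) : ℝ :=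
  (n : ℝ) / (n + 1) * f (n - 1) + ρ / (n + 1) * f (n + 1)

/-- The tail probability, conditioned on the first pair of input variables. -/
lemma survival_eq_integral_prod (ρ : ℝ) (n : ℕ) (t : ℝ) :
    survival ρ n t = ∫ e, (∫ u : unitInterval, inputLaw.real {ω | ENNReal.ofReal t <
      holdingTime ρ e (some n) + absorptionTime ρ (jump ρ u (some n)) ω}) ∂(expMeasure 1) := by
  have : IsProbabilityMeasure (expMeasure 1) := isProbabilityMeasure_expMeasure one_pos
  let μ := (expMeasure 1).prod (volume : Measure unitInterval)
  let S : Set Input := {ω | ENNReal.ofReal t < absorptionTime ρ (some n) ω}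
  have hS : MeasurableSet S := measurableSet_lt measurable_const (measurable_absorptionTime ρ _)
  have hS' : MeasurableSet (consInput ⁻¹' S) := measurable_consInput hS
  have hG : ∀ p : ℝ × unitInterval, Prod.mk p ⁻¹' (consInput ⁻¹' S) = {ω | ENNReal.ofReal t <
      holdingTime ρ p.1 (some n) + absorptionTime ρ (jump ρ p.2 (some n)) ω} := by
    intro p
    ext ω
    simp [S, absorptionTime_consInput]
  have hint := Measure.integrable_measure_prodMk_left (μ := μ) (ν := inputLaw) hS'
    (measure_ne_top _ _)
  have h1 : survival ρ n t = ∫ p, (inputLaw (Prod.mk p ⁻¹' (consInput ⁻¹' S))).toReal ∂μ := by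
    rw [survival_eq_absorptionTime, integral_toReal
      (measurable_measure_prodMk_left hS').aemeasurable
      (Filter.Eventually.of_forall fun p => measure_lt_top _ _), ← Measure.prod_apply hS',
      ← Measure.map_apply measurable_consInput hS]
    have := map_consInput_infinitePi μ
    rw [show inputLaw = Measure.infinitePi fun _ : ℕ => μ from rfl, this]
    rfl
  rw [h1]
  simp only [hG] at hint ⊢
  exact integral_prod _ hint

lemma integral_expMeasure_one (Q : ℝ → ℝ) :
    ∫ e, Q e ∂(expMeasure 1) = ∫ e in Ioi 0, Real.exp (-e) * Q e := by
  have h : expMeasure 1 = volume.withDensity (exponentialPDF 1) := rfl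
  have hm : Measurable (exponentialPDF 1) :=
    (measurable_exponentialPDFReal 1).ennreal_ofReal
  rw [h, integral_withDensity_eq_integral_toReal_smul hm
    (Filter.Eventually.of_forall fun _ => ENNReal.ofReal_lt_top), ← integral_Ici_eq_integral_Ioi,
    ← integral_indicator measurableSet_Ici]
  congr 1 with e
  rw [exponentialPDF_eq]
  by_cases he : 0 ≤ e
  · simp [he, ENNReal.toReal_ofReal (Real.exp_pos _).le]
  · simp [he]

/-- The tail probability given that the first exponential variable is `e`: either the first holding
time `e / totalRate ρ n` exceeds `t`, or the chain restarts with the remaining time. -/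
lemma integral_first_jump {ρ : ℝ} (hρ : 0 < ρ) (n : ℕ) {t e : ℝ} (ht : 0 ≤ t) (he : 0 ≤ e) :
    (∫ u : unitInterval, inputLaw.real {ω | ENNReal.ofReal t <
      holdingTime ρ e (some n) + absorptionTime ρ (jump ρ u (some n)) ω}) =
    if totalRate ρ n * t < e then 1
      else inflow ρ (fun k => survival ρ k (t - e / totalRate ρ n)) n / totalRate ρ n := by
  have hl := totalRate_pos hρ n
  rw [integral_jump hρ n fun x => inputLaw.real {ω | ENNReal.ofReal t <
      holdingTime ρ e (some n) + absorptionTime ρ x ω}]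
  simp only [holdingTime]
  split_ifs with h
  · have h1 : ENNReal.ofReal t < ENNReal.ofReal (e / totalRate ρ n) :=
      (ENNReal.ofReal_lt_ofReal_iff_of_nonneg ht).2 (by rwa [lt_div_iff₀ hl, mul_comm])
    have h2 : ∀ x, {ω | ENNReal.ofReal t <
        ENNReal.ofReal (e / totalRate ρ n) + absorptionTime ρ x ω} = univ := fun x =>
      eq_univ_of_forall fun ω => h1.trans_le le_self_add
    simp only [h2, probReal_univ]
    rw [div_eq_one_iff_eq hl.ne', totalRate, joinProb]
    field_simp
    ring
  · have h0 : 0 ≤ e / totalRate ρ n := by positivity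
    have h1 : e / totalRate ρ n ≤ t := by rw [div_le_iff₀ hl, mul_comm]; exact not_lt.1 h
    have h2 : ∀ x, {ω | ENNReal.ofReal t <
        ENNReal.ofReal (e / totalRate ρ n) + absorptionTime ρ x ω} =
        {ω | ENNReal.ofReal (t - e / totalRate ρ n) < absorptionTime ρ x ω} := by
      intro x
      ext ω
      have : ENNReal.ofReal t =
          ENNReal.ofReal (e / totalRate ρ n) + ENNReal.ofReal (t - e / totalRate ρ n) := by
        rw [← ENNReal.ofReal_add h0 (sub_nonneg.2 h1)]; congr 1; ring
      change ENNReal.ofReal t < _ ↔ ENNReal.ofReal (t - e / totalRate ρ n) < _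
      rw [this, ENNReal.add_lt_add_iff_left ENNReal.ofReal_ne_top]
    have h3 : {ω : Input | ENNReal.ofReal (t - e / totalRate ρ n) < absorptionTime ρ none ω} = ∅ :=
      eq_empty_of_forall_notMem fun ω => by
        change ¬ _ < absorptionTime ρ none ω
        rw [absorptionTime_none]
        exact ENNReal.not_lt_zero
    rw [h2, h2, h2, h3]
    simp only [measureReal_empty, mul_zero, zero_add, inflow, survival_eq_absorptionTime]

lemma measurable_inflow_survival (ρ : ℝ) (n : ℕ) :
    Measurable fun r => inflow ρ (fun k => survival ρ k r) n :=
  ((antitone_survival ρ _).measurable.const_mul _).add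
    ((antitone_survival ρ _).measurable.const_mul _)

lemma abs_inflow_le {ρ : ℝ} (hρ : 0 < ρ) {f : ℕ → ℝ} (hf : ∀ k, |f k| ≤ 1) (n : ℕ) :
    |inflow ρ f n| ≤ 1 + ρ := by
  have hn : (0 : ℝ) < (n : ℝ) + 1 := by positivity
  have hn0 : (0 : ℝ) ≤ n := Nat.cast_nonneg n
  have h1 : (n : ℝ) / (n + 1) ≤ 1 := by rw [div_le_one hn]; linarith
  have h2 : ρ / ((n : ℝ) + 1) ≤ ρ := div_le_self hρ.le (by linarith)
  refine (abs_add_le _ _).trans (add_le_add ?_ ?_)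
  · rw [abs_mul, abs_of_nonneg (by positivity : (0 : ℝ) ≤ (n : ℝ) / (n + 1))]
    exact mul_le_one₀ h1 (abs_nonneg _) (hf _)
  · rw [abs_mul, abs_of_nonneg (by positivity : (0 : ℝ) ≤ ρ / ((n : ℝ) + 1))]
    exact (mul_le_of_le_one_right (by positivity) (hf _)).trans h2

lemma intervalIntegrable_exp_mul_inflow {ρ : ℝ} (hρ : 0 < ρ) (n : ℕ) (l a b : ℝ) :
    IntervalIntegrable (fun r => Real.exp (l * r) * inflow ρ (fun k => survival ρ k r) n)
      volume a b := by
  have h : IntervalIntegrable (fun r => Real.exp (l * r)) volume a b :=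
    (by fun_prop : Continuous fun r => Real.exp (l * r)).intervalIntegrable a b
  rw [intervalIntegrable_iff] at h ⊢
  exact h.mul_bdd (measurable_inflow_survival ρ n).aestronglyMeasurable
    (Filter.Eventually.of_forall fun r => by
      rw [Real.norm_eq_abs]; exact abs_inflow_le hρ (fun k => abs_survival_le_one ρ k r) n)

/-- The integral form of the backward equation, from the decomposition at the first jump. -/
lemma survival_integral_equation {ρ : ℝ} (hρ : 0 < ρ) (n : ℕ) {t : ℝ} (ht : 0 ≤ t) :
    survival ρ n t = Real.exp (-(totalRate ρ n * t)) * (1 + ∫ r in (0 : ℝ)..t,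
      Real.exp (totalRate ρ n * r) * inflow ρ (fun k => survival ρ k r) n) := by
  have hl := totalRate_pos hρ n
  rw [survival_eq_integral_prod, integral_expMeasure_one,
    setIntegral_congr_fun (g := fun e => Real.exp (-e) * if totalRate ρ n * t < e then 1
      else inflow ρ (fun k => survival ρ k (t - e / totalRate ρ n)) n / totalRate ρ n)
      measurableSet_Ioi
      (fun e he => by simp only [integral_first_jump hρ n ht (le_of_lt he)])]
  set l := totalRate ρ n
  set q : ℝ → ℝ := fun r => inflow ρ (fun k => survival ρ k r) n with hq
  have hlt : 0 ≤ l * t := by positivity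
  have hsub : (∫ e in (0 : ℝ)..(l * t), Real.exp (-e) * (q (t - e / l) / l)) =
      Real.exp (-(l * t)) * ∫ r in (0 : ℝ)..t, Real.exp (l * r) * q r := by
    have := intervalIntegral.integral_comp_sub_div (a := 0) (b := l * t)
      (fun r => Real.exp (l * r) * q r) hl.ne' t
    rw [show t - l * t / l = 0 by field_simp; ring, zero_div, sub_zero, smul_eq_mul] at this
    have h3 : (∫ r in (0 : ℝ)..t, Real.exp (l * r) * q r) =
        l⁻¹ * ∫ e in (0 : ℝ)..(l * t), Real.exp (l * (t - e / l)) * q (t - e / l) := by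
      rw [this]; field_simp
    rw [h3, ← mul_assoc, ← intervalIntegral.integral_const_mul]
    refine intervalIntegral.integral_congr fun e _ => ?_
    have : Real.exp (-e) = Real.exp (-(l * t)) * Real.exp (l * (t - e / l)) := by
      rw [← Real.exp_add]; congr 1; field_simp; ring
    simp only [this]
    ring
  have hF1 : EqOn (fun e => Real.exp (-e) * if l * t < e then 1 else q (t - e / l) / l)
      (fun e => Real.exp (-e) * (q (t - e / l) / l)) (Ioc 0 (l * t)) := fun e he => by
    simp [not_lt.2 he.2]
  have hF2 : EqOn (fun e => Real.exp (-e) * if l * t < e then 1 else q (t - e / l) / l)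
      (fun e => Real.exp (-e)) (Ioi (l * t)) := fun e he => by
    simp [mem_Ioi.1 he]
  have hI1 : IntegrableOn (fun e => Real.exp (-e) * (q (t - e / l) / l)) (Ioc 0 (l * t)) := by
    have h : IntegrableOn (fun e => Real.exp (-e)) (Ioc 0 (l * t)) :=
      ((by fun_prop : Continuous fun e => Real.exp (-e)).integrableOn_Icc).mono_set
        Ioc_subset_Icc_self
    have hm : Measurable fun e => q (t - e / l) / l :=
      ((measurable_inflow_survival ρ n).comp
        (by fun_prop : Measurable fun e => t - e / l)).div_const l
    refine h.mul_bdd (c := (1 + ρ) / l) hm.aestronglyMeasurable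
      (Filter.Eventually.of_forall fun r => ?_)
    rw [Real.norm_eq_abs, abs_div, abs_of_pos hl]
    gcongr
    exact abs_inflow_le hρ (fun k => abs_survival_le_one ρ k _) n
  have hI2 : IntegrableOn (fun e => Real.exp (-e)) (Ioi (l * t)) := by
    simpa using exp_neg_integrableOn_Ioi (l * t) one_pos
  rw [← Ioc_union_Ioi_eq_Ioi hlt, setIntegral_union (Ioc_disjoint_Ioi le_rfl) measurableSet_Ioi
    (hI1.congr_fun hF1.symm measurableSet_Ioc) (hI2.congr_fun hF2.symm measurableSet_Ioi),
    setIntegral_congr_fun measurableSet_Ioc hF1, setIntegral_congr_fun measurableSet_Ioi hF2,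
    integral_exp_neg_Ioi, ← intervalIntegral.integral_of_le hlt, hsub]
  ring

/-- The tail probabilities are constant on the negative half-line, so they are continuous on the
whole line. -/
lemma continuous_survival {ρ : ℝ} (hρ : 0 < ρ) (n : ℕ) : Continuous (survival ρ n) := by
  have h : survival ρ n = fun t => Real.exp (-(totalRate ρ n * max t 0)) *
      (1 + ∫ r in (0 : ℝ)..(max t 0),
        Real.exp (totalRate ρ n * r) * inflow ρ (fun k => survival ρ k r) n) := by
    funext t
    rw [← survival_integral_equation hρ n (le_max_right t 0), survival_max_zero]
  rw [h]
  have h2 : Continuous fun t => ∫ r in (0 : ℝ)..t,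
      Real.exp (totalRate ρ n * r) * inflow ρ (fun k => survival ρ k r) n :=
    intervalIntegral.continuous_primitive (fun a b =>
      intervalIntegrable_exp_mul_inflow hρ n _ a b) 0
  have h3 : Continuous fun t : ℝ => max t 0 := by fun_prop
  have h4 := h2.comp h3
  simp only [Function.comp_def] at h4
  fun_prop

lemma survival_zero {ρ : ℝ} (hρ : 0 < ρ) (n : ℕ) : survival ρ n 0 = 1 := by
  rw [survival_integral_equation hρ n le_rfl]; simp

/-- The backward Kolmogorov equation of the killed chain. -/
lemma hasDerivWithinAt_survival {ρ : ℝ} (hρ : 0 < ρ) (n : ℕ) {t : ℝ} (ht : 0 ≤ t) :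
    HasDerivWithinAt (survival ρ n)
      (inflow ρ (fun k => survival ρ k t) n - totalRate ρ n * survival ρ n t) (Ici 0) t := by
  set l := totalRate ρ n with hl
  have hc : Continuous fun r => Real.exp (l * r) * inflow ρ (fun k => survival ρ k r) n := by
    have h1 := continuous_survival hρ (n - 1)
    have h2 := continuous_survival hρ (n + 1)
    unfold inflow
    fun_prop
  have h1 := (hc.integral_hasStrictDerivAt 0 t).hasDerivAt.const_add 1
  have h2 : HasDerivAt (fun r => Real.exp (-(l * r))) (-l * Real.exp (-(l * t))) t := by
    have := ((hasDerivAt_id t).const_mul l).neg.exp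
    simpa [mul_comm] using this
  have h3 := h2.mul h1
  refine (h3.hasDerivWithinAt.congr_deriv ?_).congr
    (fun r hr => survival_integral_equation hρ n hr) (survival_integral_equation hρ n ht)
  rw [survival_integral_equation hρ n ht, ← hl]
  have : Real.exp (-(l * t)) * Real.exp (l * t) = 1 := by rw [← Real.exp_add]; simp
  linear_combination (inflow ρ (fun k => survival ρ k t) n) * this

lemma condDensity_eq {ρ : ℝ} (hρ : 0 < ρ) (n : ℕ) {t : ℝ} (ht : 0 ≤ t) :
    condDensity ρ n t =
      totalRate ρ n * survival ρ n t - inflow ρ (fun k => survival ρ k t) n := by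
  rw [condDensity, (hasDerivWithinAt_survival hρ n ht).derivWithin (uniqueDiffOn_Ici 0 t ht)]
  ring

lemma abs_condDensity_le {ρ : ℝ} (hρ : 0 < ρ) (n : ℕ) {t : ℝ} (ht : 0 ≤ t) :
    |condDensity ρ n t| ≤ 2 * (1 + ρ) := by
  rw [condDensity_eq hρ n ht]
  have h1 : totalRate ρ n ≤ 1 + ρ := by
    rw [totalRate, joinProb, mul_one_div]
    gcongr
    exact div_le_self hρ.le (by linarith [(Nat.cast_nonneg n : (0 : ℝ) ≤ n)])
  have h2 : |totalRate ρ n * survival ρ n t| ≤ 1 + ρ := by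
    rw [abs_mul, abs_of_pos (totalRate_pos hρ n)]
    exact (mul_le_of_le_one_right (totalRate_pos hρ n).le (abs_survival_le_one ρ n t)).trans h1
  have h3 := abs_inflow_le hρ (fun k => abs_survival_le_one ρ k t) n
  exact (abs_sub _ _).trans (by linarith)

/-! ### Sequences of at most exponential growth -/

/-- Sequences of at most exponential growth. Their products with `z ^ n / n!` are summable, and the
class is closed under all the operations needed for Charlier polynomials. -/
def ExpBounded (b : ℕ → ℝ) : Prop := ∃ C r : ℝ, 0 ≤ C ∧ 1 ≤ r ∧ ∀ n, |b n| ≤ C * r ^ n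

namespace ExpBounded

variable {b d : ℕ → ℝ}

lemma const (c : ℝ) : ExpBounded fun _ => c :=
  ⟨|c|, 1, abs_nonneg _, le_rfl, fun n => by simp⟩

lemma geom (s : ℝ) : ExpBounded fun n => s ^ n :=
  ⟨1, max 1 |s|, zero_le_one, le_max_left _ _, fun n => by
    rw [abs_pow, one_mul]; exact pow_le_pow_left₀ (abs_nonneg _) (le_max_right _ _) n⟩

lemma natCast : ExpBounded fun n => (n : ℝ) :=
  ⟨1, 2, zero_le_one, one_le_two, fun n => by
    rw [one_mul, Nat.abs_cast]; exact_mod_cast (Nat.lt_two_pow_self (n := n)).le⟩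

lemma add (hb : ExpBounded b) (hd : ExpBounded d) : ExpBounded fun n => b n + d n := by
  obtain ⟨C, r, hC, hr, h⟩ := hb
  obtain ⟨C', r', hC', hr', h'⟩ := hd
  refine ⟨C + C', max r r', by positivity, hr.trans (le_max_left _ _), fun n => ?_⟩
  rw [add_mul]
  refine (abs_add_le _ _).trans (add_le_add ((h n).trans ?_) ((h' n).trans ?_))
  · gcongr; exact le_max_left _ _
  · gcongr; exact le_max_right _ _

lemma mul (hb : ExpBounded b) (hd : ExpBounded d) : ExpBounded fun n => b n * d n := by
  obtain ⟨C, r, hC, hr, h⟩ := hb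
  obtain ⟨C', r', hC', hr', h'⟩ := hd
  refine ⟨C * C', r * r', by positivity, one_le_mul_of_one_le_of_one_le hr hr', fun n => ?_⟩
  rw [abs_mul, mul_pow, mul_mul_mul_comm]
  exact mul_le_mul (h n) (h' n) (abs_nonneg _) (by positivity)

lemma sub (hb : ExpBounded b) (hd : ExpBounded d) : ExpBounded fun n => b n - d n := by
  simpa [sub_eq_add_neg] using hb.add ((const (-1)).mul hd)

lemma succ (hb : ExpBounded b) : ExpBounded fun n => b (n + 1) := by
  obtain ⟨C, r, hC, hr, h⟩ := hb
  exact ⟨C * r, r, by positivity, hr, fun n => (h (n + 1)).trans_eq (by ring)⟩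

lemma pred (hb : ExpBounded b) : ExpBounded fun n => b (n - 1) := by
  obtain ⟨C, r, hC, hr, h⟩ := hb
  refine ⟨C, r, hC, hr, fun n => (h (n - 1)).trans ?_⟩
  gcongr
  exact Nat.sub_le n 1

lemma of_abs_le_one (h : ∀ n, |b n| ≤ 1) : ExpBounded b :=
  ⟨1, 1, zero_le_one, le_rfl, fun n => by simpa using h n⟩

lemma summable (hb : ExpBounded b) (z : ℝ) :
    Summable fun n => z ^ n / (n.factorial : ℝ) * b n := by
  obtain ⟨C, r, hC, hr, h⟩ := hb
  refine Summable.of_norm_bounded ((Real.summable_pow_div_factorial (|z| * r)).mul_left C)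
    fun n => ?_
  rw [Real.norm_eq_abs, abs_mul, abs_div, abs_pow, Nat.abs_cast, mul_pow]
  calc |z| ^ n / (n.factorial : ℝ) * |b n| ≤ |z| ^ n / (n.factorial : ℝ) * (C * r ^ n) := by
        gcongr; exact h n
    _ = C * (|z| ^ n * r ^ n / n.factorial) := by ring

end ExpBounded

/-- The index shift for sums against `z ^ n / n!`. -/
lemma hasSum_shift_iff {z : ℝ} (hz : z ≠ 0) (F : ℕ → ℝ) (S : ℝ) :
    HasSum (fun n => z ^ n / (n.factorial : ℝ) * (n * F (n - 1))) (z * S) ↔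
      HasSum (fun n => z ^ n / (n.factorial : ℝ) * F n) S := by
  have e : (fun n : ℕ => z ^ (n + 1) / ((n + 1).factorial : ℝ) * ((n + 1 : ℕ) * F (n + 1 - 1))) =
      fun n => z * (z ^ n / (n.factorial : ℝ) * F n) := by
    funext n
    rw [Nat.factorial_succ, pow_succ, Nat.add_sub_cancel]
    push_cast
    have : (n.factorial : ℝ) ≠ 0 := by positivity
    field_simp
  rw [← hasSum_nat_add_iff' 1, e]
  simp only [Finset.range_one, Finset.sum_singleton, Nat.cast_zero, zero_mul, mul_zero, sub_zero]
  exact hasSum_mul_left_iff hz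

lemma summable_shift_iff {z : ℝ} (hz : z ≠ 0) (F : ℕ → ℝ) :
    Summable (fun n => z ^ n / (n.factorial : ℝ) * (n * F (n - 1))) ↔
      Summable (fun n => z ^ n / (n.factorial : ℝ) * F n) := by
  constructor
  · rintro ⟨T, hT⟩
    refine ⟨z⁻¹ * T, (hasSum_shift_iff hz F _).1 ?_⟩
    rwa [mul_inv_cancel_left₀ hz]
  · rintro ⟨S, hS⟩
    exact ⟨_, (hasSum_shift_iff hz F S).2 hS⟩

lemma tsum_shift {z : ℝ} (hz : z ≠ 0) {F : ℕ → ℝ}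
    (hF : Summable (fun n => z ^ n / (n.factorial : ℝ) * F n)) :
    ∑' n, z ^ n / (n.factorial : ℝ) * (n * F (n - 1)) =
      z * ∑' n, z ^ n / (n.factorial : ℝ) * F n :=
  ((hasSum_shift_iff hz F _).2 hF.hasSum).tsum_eq

/-! ### Ladder operators for the Poisson weight -/

/-- The forward difference, which lowers the degree of a Charlier polynomial. -/
def lower (b : ℕ → ℝ) (n : ℕ) : ℝ := b (n + 1) - b n

/-- The raising operator of Charlier polynomials with parameter `a`. On exponential generating
functions it is multiplication by `1 - z / a`; it is minus the adjoint of `lower` for the weight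
`a ^ n / n!`. At `n = 0` the second term vanishes, whatever `b (0 - 1)` means. -/
def raise (a : ℝ) (b : ℕ → ℝ) (n : ℕ) : ℝ := b n - n / a * b (n - 1)

lemma lower_raise (a : ℝ) (b : ℕ → ℝ) (n : ℕ) :
    lower (raise a b) n = raise a (lower b) n - b n / a := by
  cases n with
  | zero => simp [lower, raise]; ring
  | succ n =>
    simp only [lower, raise, Nat.add_sub_cancel]
    push_cast
    ring

lemma ExpBounded.lower {b : ℕ → ℝ} (hb : ExpBounded b) : ExpBounded (lower b) := hb.succ.sub hb

lemma ExpBounded.raise {b : ℕ → ℝ} (hb : ExpBounded b) (a : ℝ) : ExpBounded (raise a b) := by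
  have := hb.sub (((ExpBounded.const a⁻¹).mul ExpBounded.natCast).mul hb.pred)
  convert this using 2 with n
  simp only [BalkingPS.raise]
  ring

/-- `raise` is minus the adjoint of `lower` for the weight `a ^ n / n!`. -/
lemma tsum_raise_mul {a : ℝ} (ha : a ≠ 0) {b d : ℕ → ℝ}
    (h1 : Summable fun n => a ^ n / (n.factorial : ℝ) * (b n * d n))
    (h2 : Summable fun n => a ^ n / (n.factorial : ℝ) * (b n * d (n + 1))) :
    ∑' n, a ^ n / (n.factorial : ℝ) * (raise a b n * d n) =
      -∑' n, a ^ n / (n.factorial : ℝ) * (b n * lower d n) := by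
  have h3 := (summable_shift_iff ha (fun n => b n * d (n + 1))).2 h2
  have h4 := tsum_shift ha h2
  have e1 : ∀ n, a ^ n / (n.factorial : ℝ) * (raise a b n * d n) =
      a ^ n / (n.factorial : ℝ) * (b n * d n) -
      a⁻¹ * (a ^ n / (n.factorial : ℝ) * (n * (b (n - 1) * d (n - 1 + 1)))) := by
    intro n
    cases n with
    | zero => simp [raise]
    | succ n => simp only [raise, Nat.add_sub_cancel]; ring
  have e2 : ∀ n, a ^ n / (n.factorial : ℝ) * (b n * lower d n) =
      a ^ n / (n.factorial : ℝ) * (b n * d (n + 1)) - a ^ n / (n.factorial : ℝ) * (b n * d n) := by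
    intro n
    simp only [lower]; ring
  simp_rw [e1, e2]
  rw [h1.tsum_sub (h3.mul_left _), h2.tsum_sub h1, tsum_mul_left, h4, inv_mul_cancel_left₀ ha]
  ring

/-! ### Charlier polynomials -/

/-- The Charlier polynomials `n ↦ C_N(n; a)`, generated by the raising operator; their exponential
generating function is `e ^ z (1 - z / a) ^ N`. -/
def charlier (a : ℝ) : ℕ → ℕ → ℝ
  | 0 => fun _ => 1
  | N + 1 => raise a (charlier a N)

lemma expBounded_charlier (a : ℝ) (N : ℕ) : ExpBounded (charlier a N) := by
  induction N with
  | zero => exact ExpBounded.const 1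
  | succ N ih => exact ih.raise a

lemma charlier_zero_right (a : ℝ) (N : ℕ) : charlier a N 0 = 1 := by
  induction N with
  | zero => rfl
  | succ N ih => simp [charlier, raise, ih]

/-- Lowering a Charlier polynomial. For `N = 0` the coefficient vanishes, so the index `0 - 1` does
not matter. -/
lemma lower_charlier (a : ℝ) (N n : ℕ) :
    lower (charlier a N) n = -(N / a * charlier a (N - 1) n) := by
  induction N generalizing n with
  | zero => simp [lower, charlier]
  | succ N ih =>
    rw [charlier, lower_raise, Nat.add_sub_cancel]
    have h : raise a (lower (charlier a N)) n = -(N / a * charlier a N n) := by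
      simp only [raise, ih]
      cases N with
      | zero => simp
      | succ N => simp only [charlier, raise, Nat.add_sub_cancel]; ring
    rw [h]
    push_cast
    ring

/-- The difference equation of the Charlier polynomials. -/
lemma charlier_recurrence {a : ℝ} (ha : a ≠ 0) (N n : ℕ) :
    a * charlier a N (n + 1) + n * charlier a N (n - 1) = (a + n - N) * charlier a N n := by
  have h1 : raise a (lower (charlier a N)) n = -(N / a * charlier a N n) := by
    simp only [raise, lower_charlier a]
    cases N with
    | zero => simp
    | succ N => simp only [charlier, raise, Nat.add_sub_cancel]; ring
  cases n with
  | zero =>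
    simp only [raise, lower] at h1
    field_simp at h1
    simp only [Nat.cast_zero] at h1 ⊢
    linear_combination h1
  | succ n =>
    simp only [raise, lower, Nat.add_sub_cancel] at h1
    field_simp at h1
    simp only [Nat.add_sub_cancel]
    linear_combination h1

lemma tsum_pow_div_factorial (z : ℝ) : ∑' n : ℕ, z ^ n / (n.factorial : ℝ) = Real.exp z := by
  rw [Real.exp_eq_exp_ℝ, NormedSpace.exp_eq_tsum_div]

/-- The exponential generating function of the Charlier polynomials. -/
lemma tsum_charlier (a : ℝ) {z : ℝ} (hz : z ≠ 0) (N : ℕ) :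
    ∑' n, z ^ n / (n.factorial : ℝ) * charlier a N n = Real.exp z * (1 - z / a) ^ N := by
  induction N with
  | zero => simp [charlier, tsum_pow_div_factorial]
  | succ N ih =>
    have h1 := (expBounded_charlier a N).summable z
    have h2 := (summable_shift_iff hz _).2 h1
    have e : ∀ n, z ^ n / (n.factorial : ℝ) * charlier a (N + 1) n =
        z ^ n / (n.factorial : ℝ) * charlier a N n -
        a⁻¹ * (z ^ n / (n.factorial : ℝ) * (n * charlier a N (n - 1))) := by
      intro n
      simp only [charlier, raise]; ring
    simp_rw [e]
    rw [h1.tsum_sub (h2.mul_left _), tsum_mul_left, tsum_shift hz h1, ih]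
    ring

lemma tsum_charlier_succ_mul {a : ℝ} (ha : a ≠ 0) (N : ℕ) {d : ℕ → ℝ} (hd : ExpBounded d) :
    ∑' n, a ^ n / (n.factorial : ℝ) * (charlier a (N + 1) n * d n) =
      -∑' n, a ^ n / (n.factorial : ℝ) * (charlier a N n * lower d n) :=
  tsum_raise_mul ha (((expBounded_charlier a N).mul hd).summable a)
    (((expBounded_charlier a N).mul hd.succ).summable a)

lemma tsum_charlier_mul_self {a : ℝ} (ha : a ≠ 0) (N : ℕ) :
    ∑' n, a ^ n / (n.factorial : ℝ) * (charlier a N n * charlier a N n) =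
      N.factorial / a ^ N * Real.exp a := by
  induction N with
  | zero => simp [charlier, tsum_pow_div_factorial]
  | succ N ih =>
    rw [tsum_charlier_succ_mul ha N (expBounded_charlier a (N + 1))]
    have e : ∀ n, a ^ n / (n.factorial : ℝ) * (charlier a N n * lower (charlier a (N + 1)) n) =
        -(((N + 1 : ℕ) : ℝ) / a) *
          (a ^ n / (n.factorial : ℝ) * (charlier a N n * charlier a N n)) := by
      intro n
      rw [lower_charlier a, Nat.add_sub_cancel]; ring
    simp_rw [e]
    rw [tsum_mul_left, ih, Nat.factorial_succ, pow_succ]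
    push_cast
    field_simp

lemma tsum_charlier_succ_mul_charlier {a : ℝ} (ha : a ≠ 0) (N : ℕ) :
    ∑' n, a ^ n / (n.factorial : ℝ) * (charlier a (N + 1) n * charlier a N n) = 0 := by
  induction N with
  | zero =>
    rw [tsum_charlier_succ_mul ha 0 (expBounded_charlier a 0)]
    simp [charlier, lower]
  | succ N ih =>
    rw [tsum_charlier_succ_mul ha _ (expBounded_charlier a (N + 1))]
    have e : ∀ n, a ^ n / (n.factorial : ℝ) *
        (charlier a (N + 1) n * lower (charlier a (N + 1)) n) = -(((N + 1 : ℕ) : ℝ) / a) *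
          (a ^ n / (n.factorial : ℝ) * (charlier a (N + 1) n * charlier a N n)) := by
      intro n
      rw [lower_charlier a, Nat.add_sub_cancel]; ring
    simp_rw [e]
    rw [tsum_mul_left, ih]
    simp

/-- The norm of a Charlier polynomial for the weight `(n + 1) a ^ n / n!`. -/
lemma tsum_charlier_sq_weighted {a : ℝ} (ha : a ≠ 0) (N : ℕ) :
    ∑' n : ℕ, a ^ n / (n.factorial : ℝ) * (((n : ℝ) + 1) * charlier a N n ^ 2) =
      (N + 1 + a) * (N.factorial / a ^ N * Real.exp a) := by
  set c := charlier a N with hc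
  have hb : ExpBounded c := expBounded_charlier a N
  have h0 := (hb.mul hb).summable a
  have h1 := (hb.succ.mul hb.succ).summable a
  have h2 := (summable_shift_iff ha (fun n => c (n + 1) * c (n + 1))).2 h1
  have e : ∀ n : ℕ, a ^ n / (n.factorial : ℝ) * (((n : ℝ) + 1) * c n ^ 2) =
      a ^ n / (n.factorial : ℝ) * (n * (c (n - 1 + 1) * c (n - 1 + 1))) +
      a ^ n / (n.factorial : ℝ) * (c n * c n) := by
    intro n
    cases n with
    | zero => simp; ring
    | succ n => simp only [Nat.add_sub_cancel]; ring
  -- `c (n + 1) = c n - N / a * charlier a (N - 1) n`, a sum of two orthogonal terms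
  have key : ∑' n, a ^ n / (n.factorial : ℝ) * (c (n + 1) * c (n + 1)) =
      (1 + N / a) * (N.factorial / a ^ N * Real.exp a) := by
    cases N with
    | zero => simp [hc, charlier, tsum_pow_div_factorial]
    | succ N =>
      have hs : ∀ n, c (n + 1) = c n - ((N + 1 : ℕ) : ℝ) / a * charlier a N n := by
        intro n
        have := lower_charlier a (N + 1) n
        simp only [lower, Nat.add_sub_cancel] at this
        linear_combination this
      have hN := expBounded_charlier a N
      have e2 : ∀ n, a ^ n / (n.factorial : ℝ) * (c (n + 1) * c (n + 1)) =
          a ^ n / (n.factorial : ℝ) * (c n * c n) -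
          2 * (((N + 1 : ℕ) : ℝ) / a) *
            (a ^ n / (n.factorial : ℝ) * (charlier a (N + 1) n * charlier a N n)) +
          (((N + 1 : ℕ) : ℝ) / a) ^ 2 *
            (a ^ n / (n.factorial : ℝ) * (charlier a N n * charlier a N n)) := by
        intro n
        rw [hs, hc]; ring
      simp_rw [e2]
      have hcr := ((hb.mul hN).summable a).mul_left (2 * (((N + 1 : ℕ) : ℝ) / a))
      have hsq := ((hN.mul hN).summable a).mul_left ((((N + 1 : ℕ) : ℝ) / a) ^ 2)
      rw [(h0.sub hcr).tsum_add hsq, h0.tsum_sub hcr, tsum_mul_left, tsum_mul_left,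
        tsum_charlier_mul_self ha, tsum_charlier_mul_self ha, tsum_charlier_succ_mul_charlier ha,
        Nat.factorial_succ, pow_succ]
      push_cast
      field_simp
      ring
  simp_rw [e]
  rw [h2.tsum_add h0, tsum_shift ha h1, key, tsum_charlier_mul_self ha]
  field_simp
  ring

/-! ### Square-summable solutions of the eigenvalue recurrence -/

/-- Square-summability for the weight `(n + 1) z ^ n / n!`. -/
def WeightedSq (z : ℝ) (f : ℕ → ℝ) : Prop :=
  Summable fun n : ℕ => z ^ n / (n.factorial : ℝ) * (((n : ℝ) + 1) * f n ^ 2)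

section WeightedSq

variable {z : ℝ} {f g : ℕ → ℝ}

lemma summable_mul_of_summable_sq (hz : 0 < z)
    (hf : Summable fun n : ℕ => z ^ n / (n.factorial : ℝ) * f n ^ 2)
    (hg : Summable fun n : ℕ => z ^ n / (n.factorial : ℝ) * g n ^ 2) :
    Summable fun n : ℕ => z ^ n / (n.factorial : ℝ) * (f n * g n) := by
  refine Summable.of_norm_bounded (hf.add hg) fun n => ?_
  have h : (0 : ℝ) ≤ z ^ n / n.factorial := by positivity
  rw [Real.norm_eq_abs, abs_mul, abs_of_nonneg h, ← mul_add]
  refine mul_le_mul_of_nonneg_left ?_ h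
  rw [abs_le]
  constructor <;> nlinarith [sq_nonneg (f n + g n), sq_nonneg (f n - g n)]

lemma summable_sq_add (hz : 0 < z)
    (hf : Summable fun n : ℕ => z ^ n / (n.factorial : ℝ) * f n ^ 2)
    (hg : Summable fun n : ℕ => z ^ n / (n.factorial : ℝ) * g n ^ 2) (c d : ℝ) :
    Summable fun n : ℕ => z ^ n / (n.factorial : ℝ) * (c * f n + d * g n) ^ 2 := by
  refine (((hf.mul_left (c ^ 2)).add (hg.mul_left (d ^ 2))).add
    ((summable_mul_of_summable_sq hz hf hg).mul_left (2 * c * d))).congr fun n => ?_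
  ring

lemma WeightedSq.sq (hz : 0 < z) (hf : WeightedSq z f) :
    Summable fun n : ℕ => z ^ n / (n.factorial : ℝ) * f n ^ 2 := by
  refine Summable.of_nonneg_of_le (fun n => by positivity) (fun n => ?_) hf
  gcongr
  nlinarith [sq_nonneg (f n), mul_nonneg (Nat.cast_nonneg n : (0 : ℝ) ≤ n) (sq_nonneg (f n))]

lemma WeightedSq.natCast_mul_sq (hz : 0 < z) (hf : WeightedSq z f) :
    Summable fun n : ℕ => z ^ n / (n.factorial : ℝ) * (n * f n ^ 2) :=
  (hf.sub (hf.sq hz)).congr fun n => by ring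

lemma natCast_mul_shift (F : ℕ → ℝ) (n : ℕ) : (n : ℝ) * F (n - 1 + 1) = n * F n := by
  cases n <;> simp

lemma WeightedSq.sq_succ (hz : 0 < z) (hf : WeightedSq z f) :
    Summable fun n : ℕ => z ^ n / (n.factorial : ℝ) * f (n + 1) ^ 2 := by
  rw [← summable_shift_iff hz.ne' (fun n => f (n + 1) ^ 2)]
  exact (hf.natCast_mul_sq hz).congr fun n => by
    rw [natCast_mul_shift (fun n => f n ^ 2)]

lemma weightedSq_iff (hz : 0 < z) :
    WeightedSq z f ↔
      Summable fun n : ℕ => z ^ n / (n.factorial : ℝ) * (n * f (n - 1)) ^ 2 := by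
  rw [WeightedSq, ← summable_shift_iff hz.ne' (fun n : ℕ => ((n : ℝ) + 1) * f n ^ 2)]
  refine summable_congr fun n => ?_
  cases n with
  | zero => simp
  | succ n => simp only [Nat.add_sub_cancel]; push_cast; ring

lemma eq_zero_of_tsum_sq_eq_zero (hz : 0 < z)
    (hf : Summable fun n : ℕ => z ^ n / (n.factorial : ℝ) * f n ^ 2)
    (h : ∑' n : ℕ, z ^ n / (n.factorial : ℝ) * f n ^ 2 = 0) (n : ℕ) : f n = 0 := by
  have h1 := (hasSum_zero_iff_of_nonneg (fun n => by positivity)).1 (h ▸ hf.hasSum)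
  have h2 := congrFun h1 n
  have h3 : z ^ n / (n.factorial : ℝ) ≠ 0 := by positivity
  simpa [h3] using h2

end WeightedSq

/-- Zero is not an eigenvalue. With `α n = f (n + 1)` and `β n = n / z * f (n - 1)`, which are
adjoint to each other, `α + β = f` forces `‖α‖ = ‖β‖`, whereas `‖β‖² - ‖α‖² = ‖f‖² / z`. -/
lemma eq_zero_of_kernel {z : ℝ} (hz : 0 < z) {f : ℕ → ℝ} (hf : WeightedSq z f)
    (h : ∀ n : ℕ, n * f (n - 1) + z * f (n + 1) = z * f n) (n : ℕ) : f n = 0 := by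
  have hα := hf.sq_succ hz
  have hβ := (weightedSq_iff hz).1 hf
  have hff := hf.sq hz
  have hnff := hf.natCast_mul_sq hz
  have hfα := summable_mul_of_summable_sq hz hff hα
  set w : ℕ → ℝ := fun n => z ^ n / (n.factorial : ℝ)
  have tα : ∑' n : ℕ, w n * (n * f n ^ 2) = z * ∑' n, w n * f (n + 1) ^ 2 := by
    rw [← tsum_shift hz.ne' hα]
    exact tsum_congr fun n => by rw [natCast_mul_shift (fun n => f n ^ 2)]
  have tβ : ∑' n : ℕ, w n * (n * f (n - 1)) ^ 2 =
      z * (∑' n : ℕ, w n * (n * f n ^ 2) + ∑' n, w n * f n ^ 2) := by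
    rw [← hnff.tsum_add hff, tsum_congr fun n : ℕ =>
      (by ring : w n * (n * f n ^ 2) + w n * f n ^ 2 = w n * (((n : ℝ) + 1) * f n ^ 2)),
      ← tsum_shift hz.ne' hf]
    refine tsum_congr fun n => ?_
    cases n with
    | zero => simp
    | succ n => simp only [Nat.add_sub_cancel]; push_cast; ring
  have tc : ∑' n : ℕ, w n * (f n * (n * f (n - 1))) = z * ∑' n, w n * (f n * f (n + 1)) := by
    rw [← tsum_shift hz.ne' hfα]
    refine tsum_congr fun n => ?_
    cases n with
    | zero => simp
    | succ n => simp only [Nat.add_sub_cancel]; ring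
  have hfβ := summable_mul_of_summable_sq hz hff hβ
  have e1 : ∑' n : ℕ, w n * (n * f (n - 1)) ^ 2 = z ^ 2 * (∑' n, w n * f n ^ 2
      - 2 * ∑' n, w n * (f n * f (n + 1)) + ∑' n, w n * f (n + 1) ^ 2) := by
    rw [← tsum_mul_left (a := (2 : ℝ)), ← hff.tsum_sub (hfα.mul_left 2),
      ← (hff.sub (hfα.mul_left 2)).tsum_add hα, ← tsum_mul_left]
    refine tsum_congr fun n => ?_
    rw [show (n : ℝ) * f (n - 1) = z * f n - z * f (n + 1) by linear_combination h n]
    ring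
  have e2 : z ^ 2 * ∑' n, w n * f (n + 1) ^ 2 = z ^ 2 * ∑' n, w n * f n ^ 2
      - 2 * z * ∑' n : ℕ, w n * (f n * (n * f (n - 1))) +
      ∑' n : ℕ, w n * (n * f (n - 1)) ^ 2 := by
    rw [← tsum_mul_left, ← tsum_mul_left (a := z ^ 2), ← tsum_mul_left (a := 2 * z),
      ← (hff.mul_left (z ^ 2)).tsum_sub (hfβ.mul_left (2 * z)),
      ← ((hff.mul_left (z ^ 2)).sub (hfβ.mul_left (2 * z))).tsum_add hβ]
    refine tsum_congr fun n => ?_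
    have := h n
    have e : z ^ 2 * (w n * f (n + 1) ^ 2) = w n * (z * f (n + 1)) ^ 2 := by ring
    rw [e, show z * f (n + 1) = z * f n - n * f (n - 1) by linear_combination h n]
    ring
  refine eq_zero_of_tsum_sq_eq_zero hz hff ?_ n
  have : z * ∑' n, w n * f n ^ 2 = 0 := by
    rw [tc] at e2
    rw [tα] at tβ
    nlinarith
  exact (mul_eq_zero.1 this).resolve_left hz.ne'

/-- The difference equation `-a · raise (lower b) = κ b`, satisfied by the Charlier polynomial of
degree `κ` when `κ` is a natural number. -/
def IsNumberEigen (a κ : ℝ) (b : ℕ → ℝ) : Prop :=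
  ∀ n, -a * raise a (lower b) n = κ * b n

section IsNumberEigen

variable {a κ : ℝ} {b : ℕ → ℝ}

lemma IsNumberEigen.lower (ha : a ≠ 0) (h : IsNumberEigen a κ b) :
    IsNumberEigen a (κ - 1) (lower b) := by
  intro n
  have h1 := lower_raise a (BalkingPS.lower b) n
  have h2 : -a * BalkingPS.lower (raise a (BalkingPS.lower b)) n = κ * BalkingPS.lower b n := by
    have e1 := h n
    have e2 := h (n + 1)
    rw [BalkingPS.lower, BalkingPS.lower]
    linear_combination e2 - e1
  rw [h1] at h2
  field_simp at h2 ⊢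
  linear_combination h2

lemma summable_lower_sq (ha : 0 < a) (hb : WeightedSq a b) :
    Summable fun n : ℕ => a ^ n / (n.factorial : ℝ) * lower b n ^ 2 :=
  (summable_sq_add ha (hb.sq_succ ha) (hb.sq ha) 1 (-1)).congr fun n => by
    rw [lower]; ring

/-- The number operator is `a` times the square of `lower` in the sense of quadratic forms. -/
lemma IsNumberEigen.tsum_eq (ha : 0 < a) (h : IsNumberEigen a κ b) (hb : WeightedSq a b) :
    κ * ∑' n, a ^ n / (n.factorial : ℝ) * b n ^ 2 =
      a * ∑' n, a ^ n / (n.factorial : ℝ) * BalkingPS.lower b n ^ 2 := by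
  have hl := summable_lower_sq ha hb
  have key := tsum_raise_mul ha.ne' (summable_mul_of_summable_sq ha hl (hb.sq ha))
    (summable_mul_of_summable_sq ha hl (hb.sq_succ ha))
  have e : ∀ n, κ * (a ^ n / (n.factorial : ℝ) * b n ^ 2) =
      -a * (a ^ n / (n.factorial : ℝ) * (raise a (BalkingPS.lower b) n * b n)) := by
    intro n
    linear_combination (-(a ^ n / (n.factorial : ℝ)) * b n) * h n
  rw [← tsum_mul_left, tsum_congr e, tsum_mul_left, key]
  simp only [pow_two]
  ring

/-- Lowering keeps the extra factor `n + 1` in the weight, because the equation expresses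
`n * lower b (n - 1)` through `lower b n` and `b n`. -/
lemma IsNumberEigen.weightedSq_lower (ha : 0 < a) (h : IsNumberEigen a κ b)
    (hb : WeightedSq a b) : WeightedSq a (BalkingPS.lower b) := by
  rw [weightedSq_iff ha]
  refine (summable_sq_add ha (summable_lower_sq ha hb) (hb.sq ha) a κ).congr fun n => ?_
  have := h n
  rw [raise] at this
  field_simp at this
  rw [show (n : ℝ) * BalkingPS.lower b (n - 1) = a * BalkingPS.lower b n + κ * b n by
    linear_combination this]

/-- Lowering a nonzero square-summable solution decreases `κ` by one, while the identity
`κ ‖b‖² = a ‖lower b‖²` keeps `κ` nonnegative; so the descent has to stop at `κ = 0`. -/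
lemma IsNumberEigen.exists_nat (ha : 0 < a) (h : IsNumberEigen a κ b) (hb : WeightedSq a b)
    (hb0 : b ≠ 0) : ∃ N : ℕ, κ = N := by
  obtain ⟨k, hk⟩ := exists_nat_gt κ
  induction k generalizing κ b with
  | zero =>
    exfalso
    have h1 := h.tsum_eq ha hb
    have h2 : 0 ≤ a * ∑' n, a ^ n / (n.factorial : ℝ) * BalkingPS.lower b n ^ 2 :=
      mul_nonneg ha.le (tsum_nonneg fun n => by positivity)
    have h3 : 0 ≤ ∑' n, a ^ n / (n.factorial : ℝ) * b n ^ 2 := tsum_nonneg fun n => by positivity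
    have hκ : κ < 0 := by simpa using hk
    have h4 : ∑' n, a ^ n / (n.factorial : ℝ) * b n ^ 2 = 0 := by nlinarith
    exact hb0 (funext fun n => eq_zero_of_tsum_sq_eq_zero ha (hb.sq ha) h4 n)
  | succ k ih =>
    by_cases hκ : κ = 0
    · exact ⟨0, by simpa using hκ⟩
    · have hl0 : BalkingPS.lower b ≠ 0 := by
        intro h0
        refine hb0 (funext fun n => ?_)
        have := h n
        rw [h0] at this
        simp only [raise, Pi.zero_apply, mul_zero, sub_zero] at this
        exact (mul_eq_zero.1 this.symm).resolve_left hκ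
      obtain ⟨N, hN⟩ := ih (h.lower ha.ne') (h.weightedSq_lower ha hb) hl0 (by
        push_cast at hk; linarith)
      exact ⟨N + 1, by push_cast; linarith⟩

end IsNumberEigen

/-- The eigenvalue equation of the generator `A`, shifted by one and multiplied by `n + 1`: its
solutions with `s = 1 + ν` are the eigenfunctions for `ν`. -/
def IsShiftedEigen (ρ s : ℝ) (f : ℕ → ℝ) : Prop :=
  ∀ n : ℕ, n * f (n - 1) + ρ * f (n + 1) - ρ * f n = ((n : ℝ) + 1) * s * f n

/-- The recurrence determines an eigenfunction from its value at `0`. -/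
lemma IsShiftedEigen.eq_mul_of_zero {ρ s : ℝ} (hρ : ρ ≠ 0) {f g : ℕ → ℝ}
    (hf : IsShiftedEigen ρ s f) (hg : IsShiftedEigen ρ s g) (hg0 : g 0 = 1) (n : ℕ) :
    f n = f 0 * g n := by
  have key : ∀ n, f n = f 0 * g n ∧ f (n + 1) = f 0 * g (n + 1) := by
    intro n
    induction n with
    | zero =>
      refine ⟨by rw [hg0, mul_one], mul_left_cancel₀ hρ ?_⟩
      have h1 := hf 0
      have h2 := hg 0
      simp only [Nat.cast_zero, zero_mul, zero_add] at h1 h2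
      rw [hg0] at h2
      linear_combination h1 - f 0 * h2
    | succ n ih =>
      refine ⟨ih.2, mul_left_cancel₀ hρ ?_⟩
      have h1 := hf (n + 1)
      have h2 := hg (n + 1)
      simp only [Nat.add_sub_cancel] at h1 h2
      rw [ih.1, ih.2] at h1
      linear_combination h1 - f 0 * h2
  exact (key n).1

/-- The square-summable eigenfunctions belong to the values `s` with `m s² + ρ s = ρ`. -/
lemma IsShiftedEigen.exists_quadratic {ρ s : ℝ} (hρ : 0 < ρ) {f : ℕ → ℝ}
    (hf : IsShiftedEigen ρ s f) (hw : WeightedSq ρ f) (hf0 : f ≠ 0) :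
    ∃ m : ℕ, 0 < m ∧ (m : ℝ) * s ^ 2 + ρ * s = ρ := by
  by_cases hs : s = 0
  · subst hs
    exact absurd (funext fun n => eq_zero_of_kernel hρ hw
      (fun n => by linear_combination hf n) n) hf0
  -- rescaling by `s ^ n` turns the equation into that of a number operator with parameter `a`
  set a := ρ / s ^ 2 with ha
  have ha0 : 0 < a := by positivity
  have hρa : ρ = a * s ^ 2 := by rw [ha]; field_simp
  set b : ℕ → ℝ := fun n => s ^ n * f n with hb
  have hbw : WeightedSq a b := by
    refine Summable.congr hw fun n => ?_
    simp only [hb, ha, div_pow]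
    field_simp
    ring
  have hb0 : b ≠ 0 := by
    intro h0
    refine hf0 (funext fun n => ?_)
    have := congrFun h0 n
    simpa [hb, hs] using this
  have heig : IsNumberEigen a (a - 1 - a * s) b := by
    intro n
    have h1 := hf n
    rw [hρa] at h1
    have e : ∀ k X Y : ℝ, -a * (X - k / a * Y) = k * Y - a * X := fun k X Y => by
      field_simp; ring
    rw [raise, e]
    cases n with
    | zero =>
      simp only [lower, hb, Nat.cast_zero, zero_mul, zero_add, pow_zero, pow_one] at h1 ⊢
      refine mul_left_cancel₀ hs ?_
      linear_combination -h1
    | succ n =>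
      simp only [lower, hb, Nat.add_sub_cancel, ] at h1 ⊢
      push_cast at h1 ⊢
      linear_combination -(s ^ n) * h1
  obtain ⟨N, hN⟩ := heig.exists_nat ha0 hbw hb0
  refine ⟨N + 1, N.succ_pos, ?_⟩
  push_cast
  rw [← hN, hρa]
  ring

/-! ### Diagonal and shift operators on `ℓ²` -/

/-- The real Hilbert space `ℓ²(ℕ)`. -/
abbrev EllTwo : Type := lp (fun _ : ℕ => ℝ) 2

lemma memLp_two_of_summable_sq {f : ℕ → ℝ} (hf : Summable fun n => f n ^ 2) :
    Memℓp (E := fun _ : ℕ => ℝ) f 2 := by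
  refine memℓp_gen ?_
  simpa using hf

lemma summable_sq_coe (x : EllTwo) : Summable fun n => x n ^ 2 := by
  have := lp.summable_inner (𝕜 := ℝ) x x
  simpa [pow_two] using this

lemma inner_eq_tsum_mul (x y : EllTwo) : inner ℝ x y = ∑' n, x n * y n := by
  rw [lp.inner_eq_tsum]
  exact tsum_congr fun n => by simp [mul_comm]

lemma norm_sq_eq_tsum (x : EllTwo) : ‖x‖ ^ 2 = ∑' n, x n ^ 2 := by
  rw [← real_inner_self_eq_norm_sq, inner_eq_tsum_mul]
  exact tsum_congr fun n => (pow_two _).symm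

lemma norm_smul_id_le {d : ℕ → ℝ} {C : ℝ} (hC : ∀ n, |d n| ≤ C) (n : ℕ) :
    ‖d n • ContinuousLinearMap.id ℝ ℝ‖ ≤ C := by
  simpa [norm_smul] using hC n

/-- Multiplication by a bounded sequence. -/
def diagonal (d : ℕ → ℝ) {C : ℝ} (hC0 : 0 ≤ C) (hC : ∀ n, |d n| ≤ C) : EllTwo →L[ℝ] EllTwo :=
  lp.mapCLM 2 (fun n => d n • ContinuousLinearMap.id ℝ ℝ) hC0 (norm_smul_id_le hC)

section Diagonal

variable {d : ℕ → ℝ} {C : ℝ} (hC0 : 0 ≤ C) (hC : ∀ n, |d n| ≤ C)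

@[simp] lemma diagonal_apply (x : EllTwo) (n : ℕ) : diagonal d hC0 hC x n = d n * x n := by
  simp [diagonal]

lemma norm_diagonal_le : ‖diagonal d hC0 hC‖ ≤ C := lp.norm_mapCLM_le 2 _ hC0 (norm_smul_id_le hC)

lemma isSelfAdjoint_diagonal : IsSelfAdjoint (diagonal d hC0 hC) := by
  rw [ContinuousLinearMap.isSelfAdjoint_iff_isSymmetric]
  intro x y
  change inner ℝ (diagonal d hC0 hC x) y = inner ℝ x (diagonal d hC0 hC y)
  rw [inner_eq_tsum_mul, inner_eq_tsum_mul]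
  exact tsum_congr fun n => by rw [diagonal_apply, diagonal_apply]; ring

/-- A diagonal operator whose entries tend to zero is a norm limit of operators of finite rank. -/
lemma isCompactOperator_diagonal (hd : Filter.Tendsto d Filter.atTop (nhds 0)) :
    IsCompactOperator (diagonal d hC0 hC) := by
  let T : ℕ → EllTwo →L[ℝ] EllTwo := fun N => ∑ i ∈ Finset.range N,
    d i • (lp.singleContinuousLinearMap ℝ (fun _ : ℕ => ℝ) 2 i).comp
      (lp.evalCLM ℝ (fun _ : ℕ => ℝ) 2 i)
  have hT : ∀ N, IsCompactOperator (T N) := by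
    intro N
    have : T N ∈ compactOperator (RingHom.id ℝ) EllTwo EllTwo := by
      refine Submodule.sum_mem _ fun i _ => Submodule.smul_mem _ _ ?_
      exact IsCompactOperator.clm_comp (isCompactOperator_of_locallyCompactSpace_dom
        (lp.evalCLM ℝ (fun _ : ℕ => ℝ) 2 i))
        (lp.singleContinuousLinearMap ℝ (fun _ : ℕ => ℝ) 2 i)
    exact this
  have hTapp : ∀ N (x : EllTwo) n, T N x n = if n < N then d n * x n else 0 := by
    intro N x n
    have h1 : T N x = ∑ i ∈ Finset.range N, d i • lp.single 2 i (x i) := by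
      simp only [T, sum_apply]
      rfl
    rw [h1, lp.coeFn_sum, Finset.sum_apply]
    simp only [lp.coeFn_smul, Pi.smul_apply, lp.single_apply, smul_eq_mul, Pi.single_apply,
      mul_ite, mul_zero, Finset.sum_ite_eq, Finset.mem_range]
  refine isCompactOperator_of_tendsto (l := Filter.atTop) (F := T) ?_
    (Filter.Eventually.of_forall hT)
  rw [Metric.tendsto_atTop]
  intro ε hε
  obtain ⟨N, hN⟩ := (Metric.tendsto_atTop.1 hd) (ε / 2) (by positivity)
  refine ⟨N, fun k hk => ?_⟩
  have hd' : ∀ n, |(if n < k then 0 else -d n)| ≤ ε / 2 := by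
    intro n
    split_ifs with h
    · simp; positivity
    · have := hN n (hk.trans (not_lt.1 h))
      rw [Real.dist_0_eq_abs] at this
      rw [abs_neg]; exact this.le
  have heq : T k - diagonal d hC0 hC = diagonal _ (by positivity) hd' := by
    ext x n
    rw [sub_apply, lp.coeFn_sub, Pi.sub_apply, hTapp, diagonal_apply,
      diagonal_apply]
    split_ifs <;> ring
  rw [dist_eq_norm, heq]
  exact (norm_diagonal_le _ _).trans_lt (by linarith)

end Diagonal

/-- The left shift on `ℓ²`. -/
def leftShift : EllTwo →L[ℝ] EllTwo :=
  LinearMap.mkContinuous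
    { toFun := fun x => ⟨fun n => x (n + 1),
        memLp_two_of_summable_sq ((summable_nat_add_iff 1).2 (summable_sq_coe x))⟩
      map_add' := fun _ _ => rfl
      map_smul' := fun _ _ => rfl } 1 fun x => by
    rw [one_mul]
    rw [← pow_le_pow_iff_left₀ (norm_nonneg _) (norm_nonneg _) two_ne_zero, norm_sq_eq_tsum,
      norm_sq_eq_tsum, (summable_sq_coe x).tsum_eq_zero_add]
    exact le_add_of_nonneg_left (sq_nonneg (x 0))

@[simp] lemma leftShift_apply (x : EllTwo) (n : ℕ) : leftShift x n = x (n + 1) := rfl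

/-! ### The symmetrized generator -/

/-- The square roots of the weights `(n + 1) ρ ^ n / n!` that symmetrize the generator. -/
def rootWeight (ρ : ℝ) (n : ℕ) : ℝ := √(ρ ^ n / (n.factorial : ℝ) * ((n : ℝ) + 1))

/-- The off-diagonal entries of the symmetrized generator. -/
def offDiag (ρ : ℝ) (n : ℕ) : ℝ := √(ρ / ((n : ℝ) + 2))

lemma rootWeight_pos {ρ : ℝ} (hρ : 0 < ρ) (n : ℕ) : 0 < rootWeight ρ n :=
  Real.sqrt_pos.2 (by positivity)

lemma rootWeight_sq {ρ : ℝ} (hρ : 0 < ρ) (n : ℕ) :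
    rootWeight ρ n ^ 2 = ρ ^ n / (n.factorial : ℝ) * ((n : ℝ) + 1) := Real.sq_sqrt (by positivity)

lemma offDiag_mul_rootWeight_succ {ρ : ℝ} (hρ : 0 < ρ) (n : ℕ) :
    offDiag ρ n * rootWeight ρ (n + 1) = ρ / ((n : ℝ) + 1) * rootWeight ρ n := by
  rw [offDiag, rootWeight, rootWeight, ← Real.sqrt_mul (by positivity),
    ← Real.sqrt_sq (by positivity : 0 ≤ ρ / ((n : ℝ) + 1)), ← Real.sqrt_mul (by positivity),
    Nat.factorial_succ, pow_succ]
  congr 1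
  push_cast
  field_simp
  ring

lemma offDiag_mul_rootWeight {ρ : ℝ} (hρ : 0 < ρ) (n : ℕ) :
    offDiag ρ n * rootWeight ρ n = ((n : ℝ) + 1) / (n + 2) * rootWeight ρ (n + 1) := by
  rw [offDiag, rootWeight, rootWeight, ← Real.sqrt_mul (by positivity),
    ← Real.sqrt_sq (by positivity : 0 ≤ ((n : ℝ) + 1) / (n + 2)), ← Real.sqrt_mul (by positivity),
    Nat.factorial_succ, pow_succ]
  congr 1
  push_cast
  field_simp
  ring

lemma abs_div_add_le {ρ : ℝ} (hρ : 0 < ρ) (n : ℕ) : |-(ρ / ((n : ℝ) + 1))| ≤ ρ := by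
  rw [abs_neg, abs_of_pos (by positivity)]
  exact div_le_self hρ.le (by linarith [(Nat.cast_nonneg n : (0 : ℝ) ≤ n)])

lemma abs_offDiag_le {ρ : ℝ} (hρ : 0 < ρ) (n : ℕ) : |offDiag ρ n| ≤ √ρ := by
  rw [offDiag, abs_of_nonneg (Real.sqrt_nonneg _)]
  exact Real.sqrt_le_sqrt (div_le_self hρ.le (by linarith [(Nat.cast_nonneg n : (0 : ℝ) ≤ n)]))

/-- The strictly upper triangular part of the symmetrized generator. -/
def upperPart {ρ : ℝ} (hρ : 0 < ρ) : EllTwo →L[ℝ] EllTwo :=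
  (diagonal (offDiag ρ) (Real.sqrt_nonneg ρ) (abs_offDiag_le hρ)).comp leftShift

/-- The generator of the killed chain plus the identity, conjugated by `rootWeight` into a Jacobi
operator on `ℓ²`. -/
def jacobi {ρ : ℝ} (hρ : 0 < ρ) : EllTwo →L[ℝ] EllTwo :=
  diagonal (fun n => -(ρ / ((n : ℝ) + 1))) hρ.le (abs_div_add_le hρ) +
    (upperPart hρ + ContinuousLinearMap.adjoint (upperPart hρ))

lemma upperPart_apply {ρ : ℝ} (hρ : 0 < ρ) (x : EllTwo) (n : ℕ) :
    upperPart hρ x n = offDiag ρ n * x (n + 1) := by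
  simp [upperPart]

lemma adjoint_upperPart_apply {ρ : ℝ} (hρ : 0 < ρ) (x : EllTwo) (n : ℕ) :
    ContinuousLinearMap.adjoint (upperPart hρ) x n =
      if n = 0 then 0 else offDiag ρ (n - 1) * x (n - 1) := by
  have h1 : ContinuousLinearMap.adjoint (upperPart hρ) x n =
      inner ℝ (upperPart hρ (lp.single 2 n (1 : ℝ))) x := by
    rw [← ContinuousLinearMap.adjoint_inner_right, lp.inner_single_left]
    simp
  rw [h1, inner_eq_tsum_mul]
  simp only [upperPart_apply, lp.single_apply, Pi.single_apply]
  cases n with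
  | zero => simp
  | succ n => simp

lemma tendsto_const_div_natCast_add (c : ℝ) (k : ℕ) :
    Filter.Tendsto (fun n : ℕ => c / ((n : ℝ) + k)) Filter.atTop (nhds 0) := by
  have h := (tendsto_const_div_atTop_nhds_zero_nat c).comp (Filter.tendsto_add_atTop_nat k)
  refine h.congr fun n => ?_
  simp

lemma isCompactOperator_jacobi {ρ : ℝ} (hρ : 0 < ρ) : IsCompactOperator (jacobi hρ) := by
  have h1 : IsCompactOperator (diagonal (fun n => -(ρ / ((n : ℝ) + 1))) hρ.le
      (abs_div_add_le hρ)) := by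
    refine isCompactOperator_diagonal _ _ ?_
    simpa using (tendsto_const_div_natCast_add ρ 1).neg
  have h2 : IsCompactOperator (diagonal (offDiag ρ) (Real.sqrt_nonneg ρ) (abs_offDiag_le hρ)) := by
    refine isCompactOperator_diagonal _ _ ?_
    have := (tendsto_const_div_natCast_add ρ 2).sqrt
    rw [Real.sqrt_zero] at this
    exact this
  have h3 : ContinuousLinearMap.adjoint (upperPart hρ) =
      (ContinuousLinearMap.adjoint leftShift).comp
        (diagonal (offDiag ρ) (Real.sqrt_nonneg ρ) (abs_offDiag_le hρ)) := by
    rw [upperPart, ContinuousLinearMap.adjoint_comp,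
      (ContinuousLinearMap.isSelfAdjoint_iff'.1 (isSelfAdjoint_diagonal _ _))]
  refine h1.add (IsCompactOperator.add (h2.comp_clm leftShift) ?_)
  rw [h3]
  exact h2.clm_comp (ContinuousLinearMap.adjoint leftShift)

lemma isSymmetric_jacobi {ρ : ℝ} (hρ : 0 < ρ) : (jacobi hρ).IsSymmetric := by
  rw [← ContinuousLinearMap.isSelfAdjoint_iff_isSymmetric]
  exact (isSelfAdjoint_diagonal _ _).add (IsSelfAdjoint.add_star_self _)

/-- A sequence that is square-summable for the weight `(n + 1) ρ ^ n / n!`, as a vector in `ℓ²`. -/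
def embed {ρ : ℝ} (hρ : 0 < ρ) {f : ℕ → ℝ} (hf : WeightedSq ρ f) : EllTwo :=
  ⟨fun n => rootWeight ρ n * f n, memLp_two_of_summable_sq (hf.congr fun n => by
    rw [mul_pow, rootWeight_sq hρ]; ring)⟩

@[simp] lemma embed_apply {ρ : ℝ} (hρ : 0 < ρ) {f : ℕ → ℝ} (hf : WeightedSq ρ f) (n : ℕ) :
    embed hρ hf n = rootWeight ρ n * f n := rfl

lemma inner_embed {ρ : ℝ} (hρ : 0 < ρ) {f g : ℕ → ℝ} (hf : WeightedSq ρ f)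
    (hg : WeightedSq ρ g) : inner ℝ (embed hρ hf) (embed hρ hg) =
      ∑' n : ℕ, ρ ^ n / (n.factorial : ℝ) * (((n : ℝ) + 1) * (f n * g n)) := by
  rw [inner_eq_tsum_mul]
  refine tsum_congr fun n => ?_
  rw [embed_apply, embed_apply]
  linear_combination f n * g n * rootWeight_sq hρ n

lemma exists_eq_embed {ρ : ℝ} (hρ : 0 < ρ) (x : EllTwo) :
    ∃ (f : ℕ → ℝ) (hf : WeightedSq ρ f), x = embed hρ hf := by
  have h0 : ∀ n, rootWeight ρ n ≠ 0 := fun n => (rootWeight_pos hρ n).ne'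
  have hx : ∀ n, rootWeight ρ n * (x n / rootWeight ρ n) = x n := fun n => by
    rw [mul_div_cancel₀ _ (h0 n)]
  refine ⟨fun n => x n / rootWeight ρ n, (summable_sq_coe x).congr fun n => ?_, ?_⟩
  · have := rootWeight_sq hρ n
    rw [← mul_assoc, ← this, ← mul_pow, hx]
  · ext n
    exact (hx n).symm

lemma jacobi_embed_apply {ρ : ℝ} (hρ : 0 < ρ) {f : ℕ → ℝ} (hf : WeightedSq ρ f) (n : ℕ) :
    jacobi hρ (embed hρ hf) n = rootWeight ρ n *
      ((n * f (n - 1) + ρ * f (n + 1) - ρ * f n) / ((n : ℝ) + 1)) := by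
  have h1 : jacobi hρ (embed hρ hf) n =
      -(ρ / ((n : ℝ) + 1)) * (rootWeight ρ n * f n) +
      (offDiag ρ n * (rootWeight ρ (n + 1) * f (n + 1)) +
        if n = 0 then 0 else offDiag ρ (n - 1) * (rootWeight ρ (n - 1) * f (n - 1))) := by
    rw [← embed_apply hρ hf, ← embed_apply hρ hf, ← embed_apply hρ hf, ← upperPart_apply,
      ← adjoint_upperPart_apply hρ, ← diagonal_apply hρ.le (abs_div_add_le hρ)]
    rfl
  rw [h1, ← mul_assoc (offDiag ρ n), offDiag_mul_rootWeight_succ hρ]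
  cases n with
  | zero => simp; ring
  | succ n =>
    rw [if_neg n.succ_ne_zero, Nat.add_sub_cancel, ← mul_assoc (offDiag ρ n),
      offDiag_mul_rootWeight hρ]
    push_cast
    have : (n : ℝ) + 1 + 1 ≠ 0 := by positivity
    have : (n : ℝ) + 2 ≠ 0 := by positivity
    field_simp
    ring

/-- Under the embedding, eigenvectors of the Jacobi operator are eigenfunctions of the
generator. -/
lemma jacobi_embed_eq_smul_iff {ρ : ℝ} (hρ : 0 < ρ) {f : ℕ → ℝ} (hf : WeightedSq ρ f) (s : ℝ) :
    jacobi hρ (embed hρ hf) = s • embed hρ hf ↔ IsShiftedEigen ρ s f := by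
  rw [lp.ext_iff, funext_iff]
  refine forall_congr' fun n => ?_
  rw [jacobi_embed_apply, lp.coeFn_smul, Pi.smul_apply, embed_apply, smul_eq_mul,
    mul_left_comm s, mul_right_inj' (rootWeight_pos hρ n).ne', div_eq_iff (by positivity)]
  rw [show s * f n * ((n : ℝ) + 1) = ((n : ℝ) + 1) * s * f n by ring]

/-! ### The eigenbasis -/

/-- Eigenvalues are indexed by two copies of the positive naturals, one for each branch. -/
abbrev SpecIndex : Type := ℕ+ ⊕ ℕ+

/-- The number `m` belonging to an index. -/
def SpecIndex.deg : SpecIndex → ℕ+ := Sum.elim id id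

/-- The eigenvalue belonging to an index. -/
def eigenvalue (ρ : ℝ) : SpecIndex → ℝ :=
  Sum.elim (fun m => eigPlus ρ m) (fun m => eigMinus ρ m)

section Roots

variable {ρ : ℝ}

lemma sqrt_disc_sq (hρ : 0 < ρ) (m : ℕ) :
    √(ρ ^ 2 + 4 * (m : ℝ) * ρ) ^ 2 = ρ ^ 2 + 4 * (m : ℝ) * ρ :=
  Real.sq_sqrt (by positivity)

lemma lt_sqrt_disc (hρ : 0 < ρ) {m : ℕ} (hm : 0 < m) : ρ < √(ρ ^ 2 + 4 * (m : ℝ) * ρ) := by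
  refine Real.lt_sqrt_of_sq_lt ?_
  have : 0 < 4 * (m : ℝ) * ρ := by positivity
  linarith

lemma one_add_eigPlus_pos (hρ : 0 < ρ) {m : ℕ} (hm : 0 < m) : 0 < 1 + eigPlus ρ m := by
  have h := lt_sqrt_disc hρ hm
  rw [eigPlus, add_neg_cancel_left]
  exact mul_pos (by positivity) (by linarith)

lemma one_add_eigMinus_neg (hρ : 0 < ρ) {m : ℕ} (hm : 0 < m) : 1 + eigMinus ρ m < 0 := by
  have h := lt_sqrt_disc hρ hm
  rw [eigMinus, add_neg_cancel_left]
  exact mul_neg_of_pos_of_neg (by positivity) (by linarith)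

lemma quadratic_eigPlus (hρ : 0 < ρ) {m : ℕ} (hm : 0 < m) :
    (m : ℝ) * (1 + eigPlus ρ m) ^ 2 + ρ * (1 + eigPlus ρ m) = ρ := by
  have h := sqrt_disc_sq hρ m
  rw [eigPlus, add_neg_cancel_left]
  generalize √(ρ ^ 2 + 4 * (m : ℝ) * ρ) = r at h ⊢
  have : (m : ℝ) ≠ 0 := by positivity
  field_simp
  linear_combination h

lemma quadratic_eigMinus (hρ : 0 < ρ) {m : ℕ} (hm : 0 < m) :
    (m : ℝ) * (1 + eigMinus ρ m) ^ 2 + ρ * (1 + eigMinus ρ m) = ρ := by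
  have h := sqrt_disc_sq hρ m
  rw [eigMinus, add_neg_cancel_left]
  generalize √(ρ ^ 2 + 4 * (m : ℝ) * ρ) = r at h ⊢
  have : (m : ℝ) ≠ 0 := by positivity
  field_simp
  linear_combination h

lemma eq_of_quadratic (hρ : 0 < ρ) {m : ℕ} (hm : 0 < m) {s : ℝ}
    (hs : (m : ℝ) * s ^ 2 + ρ * s = ρ) : s = 1 + eigPlus ρ m ∨ s = 1 + eigMinus ρ m := by
  have h := sqrt_disc_sq hρ m
  have hm' : (m : ℝ) ≠ 0 := by positivity
  rw [eigPlus, eigMinus, add_neg_cancel_left, add_neg_cancel_left]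
  generalize √(ρ ^ 2 + 4 * (m : ℝ) * ρ) = r at h ⊢
  have h2 : (2 * m * s + ρ - r) * (2 * m * s + ρ + r) = 0 := by
    linear_combination 4 * m * hs - h
  rcases mul_eq_zero.1 h2 with h3 | h3
  · left
    field_simp
    linear_combination h3
  · right
    field_simp
    linear_combination h3

lemma quadratic_eigenvalue (hρ : 0 < ρ) (i : SpecIndex) :
    ((i.deg : ℕ) : ℝ) * (1 + eigenvalue ρ i) ^ 2 + ρ * (1 + eigenvalue ρ i) = ρ := by
  rcases i with m | m
  · exact quadratic_eigPlus hρ m.pos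
  · exact quadratic_eigMinus hρ m.pos

lemma one_add_eigenvalue_ne_zero (hρ : 0 < ρ) (i : SpecIndex) : 1 + eigenvalue ρ i ≠ 0 := by
  rcases i with m | m
  · exact (one_add_eigPlus_pos hρ m.pos).ne'
  · exact (one_add_eigMinus_neg hρ m.pos).ne

lemma eigenvalue_neg (hρ : 0 < ρ) (i : SpecIndex) : eigenvalue ρ i < 0 := by
  have h1 := quadratic_eigenvalue hρ i
  have h2 : 0 < ((i.deg : ℕ) : ℝ) * (1 + eigenvalue ρ i) ^ 2 :=
    mul_pos (by exact_mod_cast i.deg.pos)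
      (sq_pos_of_ne_zero (one_add_eigenvalue_ne_zero hρ i))
  nlinarith

/-- All eigenvalues are distinct: `s` determines `m` through the quadratic equation, and its sign
tells the branch. -/
lemma eigenvalue_injective (hρ : 0 < ρ) : Function.Injective (eigenvalue ρ) := by
  intro i j hij
  have h1 := quadratic_eigenvalue hρ i
  have h2 := quadratic_eigenvalue hρ j
  rw [← hij] at h2
  have hd : i.deg = j.deg := by
    have : ((i.deg : ℕ) : ℝ) = ((j.deg : ℕ) : ℝ) :=
      mul_right_cancel₀ (pow_ne_zero 2 (one_add_eigenvalue_ne_zero hρ i)) (by linarith)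
    exact_mod_cast this
  rcases i with m | m <;> rcases j with k | k
  · exact congrArg _ hd
  · have a1 := one_add_eigPlus_pos hρ m.pos
    have a2 := one_add_eigMinus_neg hρ k.pos
    simp only [eigenvalue, Sum.elim_inl, Sum.elim_inr] at hij
    linarith
  · have a1 := one_add_eigPlus_pos hρ k.pos
    have a2 := one_add_eigMinus_neg hρ m.pos
    simp only [eigenvalue, Sum.elim_inl, Sum.elim_inr] at hij
    linarith
  · exact congrArg _ hd

lemma exists_eigenvalue_of_quadratic (hρ : 0 < ρ) {m : ℕ} (hm : 0 < m) {s : ℝ}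
    (hs : (m : ℝ) * s ^ 2 + ρ * s = ρ) : ∃ i : SpecIndex, s = 1 + eigenvalue ρ i := by
  rcases eq_of_quadratic hρ hm hs with h | h
  · exact ⟨Sum.inl ⟨m, hm⟩, h⟩
  · exact ⟨Sum.inr ⟨m, hm⟩, h⟩

end Roots

lemma ExpBounded.weightedSq {b : ℕ → ℝ} (hb : ExpBounded b) (z : ℝ) : WeightedSq z b :=
  (((ExpBounded.natCast.add (ExpBounded.const 1)).mul (hb.mul hb)).summable z).congr
    fun n => by ring

/-- The eigenfunction with value `1` at `n = 0` belonging to a root `s` of `m s² + ρ s = ρ`. -/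
def eigenfun (ρ s : ℝ) (m n : ℕ) : ℝ := s⁻¹ ^ n * charlier (ρ / s ^ 2) (m - 1) n

section Eigenfun

variable {ρ s : ℝ} {m : ℕ}

lemma expBounded_eigenfun (ρ s : ℝ) (m : ℕ) : ExpBounded (eigenfun ρ s m) :=
  (ExpBounded.geom s⁻¹).mul (expBounded_charlier _ _)

lemma eigenfun_zero (ρ s : ℝ) (m : ℕ) : eigenfun ρ s m 0 = 1 := by
  simp [eigenfun, charlier_zero_right]

lemma isShiftedEigen_eigenfun (hρ : 0 < ρ) (hs : s ≠ 0) (hm : 0 < m)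
    (h : (m : ℝ) * s ^ 2 + ρ * s = ρ) : IsShiftedEigen ρ s (eigenfun ρ s m) := by
  intro n
  obtain ⟨N, rfl⟩ : ∃ N, m = N + 1 := ⟨m - 1, by omega⟩
  have ha : ρ / s ^ 2 ≠ 0 := by positivity
  have hrec := charlier_recurrence ha N n
  have hρa : ρ = ρ / s ^ 2 * s ^ 2 := by field_simp
  simp only [eigenfun, Nat.add_sub_cancel]
  set a := ρ / s ^ 2
  clear_value a
  subst hρa
  push_cast at h
  have h' : (N + 1 : ℝ) + a * s = a := by
    have : s ^ 2 * ((N + 1 : ℝ) + a * s) = s ^ 2 * a := by linear_combination h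
    exact mul_left_cancel₀ (pow_ne_zero 2 hs) this
  cases n with
  | zero =>
    simp only [Nat.cast_zero, zero_mul, zero_add, pow_zero, pow_one, one_mul, add_zero] at hrec ⊢
    field_simp
    linear_combination hrec - charlier a N 0 * h'
  | succ n =>
    simp only [Nat.add_sub_cancel, pow_succ] at hrec ⊢
    push_cast at hrec ⊢
    field_simp
    linear_combination hrec - charlier a N (n + 1) * h'

/-- The pairing of an eigenfunction with the exit rates `1 / (n + 1)`. -/
lemma tsum_eigenfun (hρ : 0 < ρ) (hs : s ≠ 0) :
    ∑' n : ℕ, ρ ^ n / (n.factorial : ℝ) * eigenfun ρ s m n =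
      Real.exp (ρ / s) * (1 - s) ^ (m - 1) := by
  have h := tsum_charlier (ρ / s ^ 2) (z := ρ / s) (by positivity) (m - 1)
  have e : ρ / s / (ρ / s ^ 2) = s := by field_simp
  rw [e] at h
  rw [← h]
  refine tsum_congr fun n => ?_
  rw [eigenfun, div_pow, inv_pow]
  field_simp

/-- The squared norm of an eigenfunction. The relation `m s² = ρ (1 - s)` turns the parameter
`ρ / s²` of the Charlier polynomials into `m / (1 - s) = m + ρ / s`. -/
lemma tsum_eigenfun_sq (hρ : 0 < ρ) (hs : s ≠ 0) (hm : 0 < m)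
    (h : (m : ℝ) * s ^ 2 + ρ * s = ρ) (hs1 : s < 1) :
    ∑' n : ℕ, ρ ^ n / (n.factorial : ℝ) *
      (((n : ℝ) + 1) * (eigenfun ρ s m n * eigenfun ρ s m n)) =
      (2 - s) / (1 - s) * (m.factorial / (m : ℝ) ^ (m - 1) * (1 - s) ^ (m - 1)) *
        (Real.exp m * Real.exp (ρ / s)) := by
  have ha : ρ / s ^ 2 ≠ 0 := by positivity
  have key := tsum_charlier_sq_weighted ha (m - 1)
  have e : ∀ n : ℕ, ρ ^ n / (n.factorial : ℝ) *
      (((n : ℝ) + 1) * (eigenfun ρ s m n * eigenfun ρ s m n)) =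
      (ρ / s ^ 2) ^ n / (n.factorial : ℝ) *
        (((n : ℝ) + 1) * charlier (ρ / s ^ 2) (m - 1) n ^ 2) := by
    intro n
    rw [eigenfun, div_pow, inv_pow, ← pow_mul]
    field_simp
    ring
  rw [tsum_congr e, key]
  have h1 : 1 - s ≠ 0 := by linarith
  have hm' : (m : ℝ) ≠ 0 := by positivity
  have e1 : ρ / s ^ 2 = m / (1 - s) := by
    rw [div_eq_div_iff (pow_ne_zero 2 hs) h1]; linear_combination -h
  have e2 : (m : ℝ) / (1 - s) = m + ρ / s := by
    field_simp
    linear_combination h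
  rw [e1, ← Real.exp_add, ← e2]
  obtain ⟨N, rfl⟩ : ∃ N, m = N + 1 := ⟨m - 1, by omega⟩
  rw [Nat.add_sub_cancel, Nat.factorial_succ, div_pow]
  push_cast at hm' ⊢
  field_simp
  ring

end Eigenfun

/-- The eigenfunction belonging to an index. -/
def specFun (ρ : ℝ) (i : SpecIndex) : ℕ → ℝ := eigenfun ρ (1 + eigenvalue ρ i) i.deg

lemma isShiftedEigen_specFun {ρ : ℝ} (hρ : 0 < ρ) (i : SpecIndex) :
    IsShiftedEigen ρ (1 + eigenvalue ρ i) (specFun ρ i) :=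
  isShiftedEigen_eigenfun hρ (one_add_eigenvalue_ne_zero hρ i) i.deg.pos (quadratic_eigenvalue hρ i)

lemma expBounded_specFun (ρ : ℝ) (i : SpecIndex) : ExpBounded (specFun ρ i) :=
  expBounded_eigenfun _ _ _

section Basis

variable {ρ : ℝ} (hρ : 0 < ρ)

/-- The eigenvector of the Jacobi operator belonging to an index. -/
def specVec (i : SpecIndex) : EllTwo := embed hρ ((expBounded_specFun ρ i).weightedSq ρ)

lemma jacobi_specVec (i : SpecIndex) :
    jacobi hρ (specVec hρ i) = (1 + eigenvalue ρ i) • specVec hρ i :=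
  (jacobi_embed_eq_smul_iff hρ _ _).2 (isShiftedEigen_specFun hρ i)

lemma specVec_ne_zero (i : SpecIndex) : specVec hρ i ≠ 0 := by
  intro h
  have h1 : specVec hρ i 0 = 0 := by rw [h]; rfl
  rw [specVec, embed_apply, specFun, eigenfun_zero, mul_one] at h1
  exact (rootWeight_pos hρ 0).ne' h1

lemma inner_specVec_of_ne {i j : SpecIndex} (hij : i ≠ j) :
    inner ℝ (specVec hρ i) (specVec hρ j) = 0 := by
  have h : inner ℝ (jacobi hρ (specVec hρ i)) (specVec hρ j) =
      inner ℝ (specVec hρ i) (jacobi hρ (specVec hρ j)) :=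
    isSymmetric_jacobi hρ (specVec hρ i) (specVec hρ j)
  rw [jacobi_specVec, jacobi_specVec, real_inner_smul_left, real_inner_smul_right] at h
  have h2 : (eigenvalue ρ i - eigenvalue ρ j) * inner ℝ (specVec hρ i) (specVec hρ j) = 0 := by
    linear_combination h
  exact (mul_eq_zero.1 h2).resolve_left (sub_ne_zero.2 fun e => hij (eigenvalue_injective hρ e))

/-- The normalized eigenvectors. -/
def specUnit (i : SpecIndex) : EllTwo := ‖specVec hρ i‖⁻¹ • specVec hρ i

lemma orthonormal_specUnit : Orthonormal ℝ (specUnit hρ) := by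
  refine ⟨fun i => ?_, fun i j hij => ?_⟩
  · exact norm_smul_inv_norm (𝕜 := ℝ) (specVec_ne_zero hρ i)
  · change inner ℝ (specUnit hρ i) (specUnit hρ j) = 0
    rw [specUnit, specUnit, real_inner_smul_left, real_inner_smul_right,
      inner_specVec_of_ne hρ hij, mul_zero, mul_zero]

/-- Every eigenvector of the Jacobi operator is proportional to one of the `specVec`, since the
recurrence determines an eigenfunction from its value at `0`. -/
lemma eigenspace_le_span (μ : ℝ) :
    Module.End.eigenspace (jacobi hρ : Module.End ℝ EllTwo) μ ≤
      Submodule.span ℝ (Set.range (specUnit hρ)) := by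
  intro x hx
  have hx' : jacobi hρ x = μ • x := Module.End.mem_eigenspace_iff.1 hx
  obtain ⟨f, hf, rfl⟩ := exists_eq_embed hρ x
  by_cases hf0 : f = 0
  · have : embed hρ hf = 0 := by
      ext n
      subst hf0
      exact mul_zero _
    rw [this]
    exact Submodule.zero_mem _
  have hE := (jacobi_embed_eq_smul_iff hρ hf μ).1 hx'
  obtain ⟨m, hm, hq⟩ := hE.exists_quadratic hρ hf hf0
  obtain ⟨i, rfl⟩ := exists_eigenvalue_of_quadratic hρ hm hq
  have hprop := hE.eq_mul_of_zero hρ.ne' (isShiftedEigen_specFun hρ i) (eigenfun_zero _ _ _)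
  have : embed hρ hf = (f 0 * ‖specVec hρ i‖) • specUnit hρ i := by
    rw [specUnit, smul_smul, mul_assoc,
      mul_inv_cancel₀ (norm_ne_zero_iff.2 (specVec_ne_zero hρ i)), mul_one]
    ext n
    rw [lp.coeFn_smul, Pi.smul_apply, specVec, embed_apply, embed_apply, hprop n, smul_eq_mul]
    ring
  rw [this]
  exact Submodule.smul_mem _ _ (Submodule.subset_span ⟨i, rfl⟩)

lemma span_specUnit_orthogonal : (Submodule.span ℝ (Set.range (specUnit hρ)))ᗮ = ⊥ := by
  rw [eq_bot_iff, ← ContinuousLinearMap.orthogonalComplement_iSup_eigenspaces_eq_bot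
    (isCompactOperator_jacobi hρ) (isSymmetric_jacobi hρ)]
  exact Submodule.orthogonal_le (iSup_le (eigenspace_le_span hρ))

/-- The Hilbert basis of normalized eigenvectors of the Jacobi operator. -/
def specBasis : HilbertBasis SpecIndex ℝ EllTwo :=
  HilbertBasis.mkOfOrthogonalEqBot (orthonormal_specUnit hρ) (span_specUnit_orthogonal hρ)

/-- Parseval's identity in terms of the eigenvectors before normalization. -/
lemma hasSum_inner_specVec (x y : EllTwo) :
    HasSum (fun i => inner ℝ x (specVec hρ i) * inner ℝ (specVec hρ i) y / ‖specVec hρ i‖ ^ 2)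
      (inner ℝ x y) := by
  have h := (specBasis hρ).hasSum_inner_mul_inner x y
  rw [specBasis, HilbertBasis.coe_mkOfOrthogonalEqBot] at h
  refine h.congr_fun ?_
  intro i
  rw [specUnit, real_inner_smul_left, real_inner_smul_right]
  field_simp

end Basis

/-! ### Spectral coefficients of the sojourn time -/

/-- The generator is symmetric for the weight `(n + 1) ρ ^ n / n!`; stated for an eigenfunction
`f` and any sequence `v` of at most exponential growth. -/
lemma tsum_mul_generator {ρ s : ℝ} (hρ : 0 < ρ) {f v : ℕ → ℝ} (hf : ExpBounded f)
    (hv : ExpBounded v) (h : IsShiftedEigen ρ s f) :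
    ∑' n : ℕ, ρ ^ n / (n.factorial : ℝ) *
      (((n : ℝ) + 1) * (f n * (totalRate ρ n * v n - inflow ρ v n))) =
    (1 - s) * ∑' n : ℕ, ρ ^ n / (n.factorial : ℝ) * (((n : ℝ) + 1) * (f n * v n)) := by
  have hn : ExpBounded fun n : ℕ => (n : ℝ) := ExpBounded.natCast
  have s1 := ((((hn.add (ExpBounded.const 1)).add (ExpBounded.const ρ)).mul (hf.mul hv)).summable ρ)
  have s2 := (hf.succ.mul hv).summable ρ
  have s2' := (summable_shift_iff hρ.ne' (fun n => f (n + 1) * v n)).2 s2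
  have s3 := (hf.mul hv.succ).summable ρ
  have s3' := (summable_shift_iff hρ.ne' (fun n => f n * v (n + 1))).2 s3
  have e1 : ∀ n : ℕ, ρ ^ n / (n.factorial : ℝ) *
      (((n : ℝ) + 1) * (f n * (totalRate ρ n * v n - inflow ρ v n))) =
      ρ ^ n / (n.factorial : ℝ) * (((n : ℝ) + 1 + ρ) * (f n * v n)) -
      ρ ^ n / (n.factorial : ℝ) * (n * (f (n - 1 + 1) * v (n - 1))) -
      ρ * (ρ ^ n / (n.factorial : ℝ) * (f n * v (n + 1))) := by
    intro n
    have h1 : (n : ℝ) * (f (n - 1 + 1) * v (n - 1)) = n * (f n * v (n - 1)) := by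
      cases n <;> simp
    rw [h1, totalRate, joinProb, inflow]
    field_simp
    ring
  have e2 : ∀ n : ℕ, (1 - s) * (ρ ^ n / (n.factorial : ℝ) * (((n : ℝ) + 1) * (f n * v n))) =
      ρ ^ n / (n.factorial : ℝ) * (((n : ℝ) + 1 + ρ) * (f n * v n)) -
      ρ * (ρ ^ n / (n.factorial : ℝ) * (f (n + 1) * v n)) -
      ρ ^ n / (n.factorial : ℝ) * (n * (f (n - 1) * v (n - 1 + 1))) := by
    intro n
    have h1 : (n : ℝ) * (f (n - 1) * v (n - 1 + 1)) = n * (f (n - 1) * v n) := by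
      cases n <;> simp
    rw [h1]
    linear_combination (ρ ^ n / (n.factorial : ℝ) * v n) * h n
  rw [← tsum_mul_left, tsum_congr e1, tsum_congr e2, (s1.sub s2').tsum_sub (s3.mul_left ρ),
    s1.tsum_sub s2', (s1.sub (s2.mul_left ρ)).tsum_sub s3', s1.tsum_sub (s2.mul_left ρ),
    tsum_shift hρ.ne' s2, tsum_shift hρ.ne' s3, tsum_mul_left, tsum_mul_left]

/-- The coefficient of the tail probabilities along an eigenfunction. -/
def survivalCoeff (ρ : ℝ) (f : ℕ → ℝ) (t : ℝ) : ℝ :=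
  ∑' n : ℕ, ρ ^ n / (n.factorial : ℝ) * (((n : ℝ) + 1) * (f n * survival ρ n t))

section Coefficients

variable {ρ s : ℝ} {f : ℕ → ℝ}

lemma summable_coeff_bound (hf : ExpBounded f) :
    Summable fun n : ℕ => |ρ ^ n / (n.factorial : ℝ) * (((n : ℝ) + 1) * f n)| :=
  (((ExpBounded.natCast.add (ExpBounded.const 1)).mul hf).summable ρ).abs

lemma continuous_survivalCoeff (hρ : 0 < ρ) (hf : ExpBounded f) :
    Continuous (survivalCoeff ρ f) := by
  refine continuous_tsum (fun n => ?_) (summable_coeff_bound (ρ := ρ) hf) fun n t => ?_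
  · have := continuous_survival hρ n
    fun_prop
  · rw [Real.norm_eq_abs, ← mul_assoc ((n : ℝ) + 1), ← mul_assoc, abs_mul]
    exact mul_le_of_le_one_right (abs_nonneg _) (abs_survival_le_one ρ n t)

lemma hasDerivAt_survivalCoeff (hρ : 0 < ρ) (hf : ExpBounded f) (h : IsShiftedEigen ρ s f)
    {t : ℝ} (ht : 0 < t) :
    HasDerivAt (survivalCoeff ρ f) ((s - 1) * survivalCoeff ρ f t) t := by
  have hd : ∀ (n : ℕ) (y : ℝ), y ∈ Ioi (0 : ℝ) →
      HasDerivAt (fun y => ρ ^ n / (n.factorial : ℝ) * (((n : ℝ) + 1) * (f n * survival ρ n y)))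
        (ρ ^ n / (n.factorial : ℝ) * (((n : ℝ) + 1) * (f n * -condDensity ρ n y))) y := by
    intro n y hy
    have h1 := (hasDerivWithinAt_survival hρ n (le_of_lt hy)).hasDerivAt (Ici_mem_nhds hy)
    have h2 : inflow ρ (fun k => survival ρ k y) n - totalRate ρ n * survival ρ n y =
        -condDensity ρ n y := by rw [condDensity_eq hρ n (le_of_lt hy)]; ring
    rw [h2] at h1
    exact ((h1.const_mul _).const_mul _).const_mul _
  have hb : ∀ (n : ℕ) (y : ℝ), y ∈ Ioi (0 : ℝ) →
      ‖ρ ^ n / (n.factorial : ℝ) * (((n : ℝ) + 1) * (f n * -condDensity ρ n y))‖ ≤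
        |ρ ^ n / (n.factorial : ℝ) * (((n : ℝ) + 1) * f n)| * (2 * (1 + ρ)) := by
    intro n y hy
    rw [Real.norm_eq_abs, ← mul_assoc ((n : ℝ) + 1), ← mul_assoc, abs_mul, abs_neg]
    exact mul_le_mul_of_nonneg_left (abs_condDensity_le hρ n (le_of_lt hy)) (abs_nonneg _)
  have hs : Summable fun n : ℕ =>
      ρ ^ n / (n.factorial : ℝ) * (((n : ℝ) + 1) * (f n * survival ρ n t)) :=
    ((ExpBounded.natCast.add (ExpBounded.const 1)).mul
      (hf.mul (ExpBounded.of_abs_le_one fun n => abs_survival_le_one ρ n t))).summable ρ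
  refine (hasDerivAt_tsum_of_isPreconnected ((summable_coeff_bound hf).mul_right _) isOpen_Ioi
    isPreconnected_Ioi hd hb (mem_Ioi.2 ht) hs (mem_Ioi.2 ht)).congr_deriv ?_
  have key := tsum_mul_generator hρ hf
    (ExpBounded.of_abs_le_one fun n => abs_survival_le_one ρ n t) h
  rw [show (s - 1) * survivalCoeff ρ f t = -((1 - s) * survivalCoeff ρ f t) by ring,
    survivalCoeff, ← key, ← tsum_neg]
  refine tsum_congr fun n => ?_
  rw [condDensity_eq hρ n ht.le]
  ring

/-- Along an eigenfunction the backward equation decouples to a scalar equation. -/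
lemma survivalCoeff_eq (hρ : 0 < ρ) (hf : ExpBounded f) (h : IsShiftedEigen ρ s f)
    {t : ℝ} (ht : 0 ≤ t) :
    survivalCoeff ρ f t = Real.exp ((s - 1) * t) * survivalCoeff ρ f 0 := by
  rcases ht.eq_or_lt with rfl | ht
  · simp
  let F : ℝ → ℝ := fun y => Real.exp (-((s - 1) * y)) * survivalCoeff ρ f y
  have hFc : Continuous F := by
    have := continuous_survivalCoeff hρ hf
    fun_prop
  have hFd : ∀ y ∈ Ioo 0 t, HasDerivAt F 0 y := by
    intro y hy
    have h1 := ((hasDerivAt_id y).const_mul (s - 1)).neg.exp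
    have h2 := h1.mul (hasDerivAt_survivalCoeff hρ hf h hy.1)
    refine h2.congr_deriv ?_
    simp only [id]
    ring
  obtain ⟨c, -, hc⟩ := exists_hasDerivAt_eq_slope F (fun _ => 0) ht hFc.continuousOn hFd
  have h3 : F t = F 0 := by
    have := (div_eq_zero_iff.1 hc.symm).resolve_right (by linarith)
    linarith
  simp only [F, mul_zero, neg_zero, Real.exp_zero, one_mul] at h3
  rw [← h3, ← mul_assoc, ← Real.exp_add]
  simp

/-- The densities along an eigenfunction; the right-hand sum is their pairing at time `0`. -/
lemma tsum_eigen_condDensity (hρ : 0 < ρ) (hf : ExpBounded f) (h : IsShiftedEigen ρ s f)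
    {t : ℝ} (ht : 0 ≤ t) :
    ∑' n : ℕ, ρ ^ n / (n.factorial : ℝ) * (((n : ℝ) + 1) * (f n * condDensity ρ n t)) =
      Real.exp ((s - 1) * t) * ∑' n : ℕ, ρ ^ n / (n.factorial : ℝ) * f n := by
  have key : ∀ {r : ℝ}, 0 ≤ r →
      ∑' n : ℕ, ρ ^ n / (n.factorial : ℝ) * (((n : ℝ) + 1) * (f n * condDensity ρ n r)) =
        (1 - s) * survivalCoeff ρ f r := by
    intro r hr
    rw [survivalCoeff, ← tsum_mul_generator hρ hf
      (ExpBounded.of_abs_le_one fun n => abs_survival_le_one ρ n r) h]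
    exact tsum_congr fun n => by rw [condDensity_eq hρ n hr]
  have h0 : ∑' n : ℕ, ρ ^ n / (n.factorial : ℝ) * f n = (1 - s) * survivalCoeff ρ f 0 := by
    rw [← key le_rfl]
    refine tsum_congr fun n => ?_
    -- the exit rate of the tagged customer is `p_n(0) = 1 / (n + 1)`
    have : condDensity ρ n 0 = 1 / ((n : ℝ) + 1) := by
      rw [condDensity_eq hρ n le_rfl, totalRate, joinProb, inflow, survival_zero hρ,
        survival_zero hρ, survival_zero hρ]
      field_simp
      ring
    rw [this]
    field_simp
  rw [key ht, h0, survivalCoeff_eq hρ hf h ht]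
  ring

end Coefficients

lemma expBounded_condDensity {ρ : ℝ} (hρ : 0 < ρ) {t : ℝ} (ht : 0 ≤ t) :
    ExpBounded fun n => condDensity ρ n t :=
  ⟨2 * (1 + ρ), 1, by positivity, le_rfl, fun n => by simpa using abs_condDensity_le hρ n ht⟩

lemma expBounded_exitRate : ExpBounded fun n : ℕ => 1 / ((n : ℝ) + 1) :=
  ExpBounded.of_abs_le_one fun n => by
    rw [abs_of_pos (by positivity), div_le_one (by positivity)]
    linarith [(Nat.cast_nonneg n : (0 : ℝ) ≤ n)]

lemma summable_mixTerm {ρ : ℝ} (hρ : 0 < ρ) {t : ℝ} (ht : 0 ≤ t) :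
    Summable fun n => mixTerm ρ t n :=
  (((expBounded_condDensity hρ ht).summable ρ).mul_left (Real.exp (-ρ))).congr fun n => by
    rw [mixTerm]; ring

/-- Parseval's identity for the exit rates `1 / (n + 1)` and the densities `p_n(t)`. -/
lemma hasSum_spectralTerm {ρ : ℝ} (hρ : 0 < ρ) {t : ℝ} (ht : 0 ≤ t) :
    HasSum (fun i : SpecIndex => spectralTerm ρ t i.deg (eigenvalue ρ i))
      (uncondDensity ρ t) := by
  have hg := expBounded_exitRate.weightedSq ρ
  have hp := (expBounded_condDensity hρ ht).weightedSq ρ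
  have h := (hasSum_inner_specVec hρ (embed hρ hg) (embed hρ hp)).mul_left (Real.exp (-ρ))
  have hsum : Real.exp (-ρ) * inner ℝ (embed hρ hg) (embed hρ hp) = uncondDensity ρ t := by
    rw [inner_embed, uncondDensity, ← tsum_mul_left]
    refine tsum_congr fun n => ?_
    rw [mixTerm]
    field_simp
  rw [hsum] at h
  refine h.congr_fun fun i => ?_
  -- evaluate the two pairings and the norm of the eigenfunction
  have hs := one_add_eigenvalue_ne_zero hρ i
  have hneg := eigenvalue_neg hρ i
  have hq := quadratic_eigenvalue hρ i
  have hm := i.deg.pos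
  have c1 : inner ℝ (embed hρ hg) (specVec hρ i) =
      ∑' n : ℕ, ρ ^ n / (n.factorial : ℝ) * specFun ρ i n := by
    rw [specVec, inner_embed]
    refine tsum_congr fun n => ?_
    field_simp
  have c2 : inner ℝ (specVec hρ i) (embed hρ hp) = Real.exp (eigenvalue ρ i * t) *
      ∑' n : ℕ, ρ ^ n / (n.factorial : ℝ) * specFun ρ i n := by
    rw [specVec, inner_embed, tsum_eigen_condDensity hρ (expBounded_specFun ρ i)
      (isShiftedEigen_specFun hρ i) ht, add_sub_cancel_left]
  have c3 := tsum_eigenfun_sq hρ hs hm hq (by linarith)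
  rw [c1, c2, ← real_inner_self_eq_norm_sq, specVec, inner_embed]
  simp only [specFun]
  rw [c3, tsum_eigenfun hρ hs, spectralTerm, coeffC, bigPhi]
  generalize eigenvalue ρ i = ν at *
  rw [add_comm 1 ν] at *
  have e1 : (1 : ℝ) - (ν + 1) = -ν := by ring
  have e2 : (2 : ℝ) - (ν + 1) = 1 - ν := by ring
  rw [e1, e2, Real.exp_neg ((i.deg : ℕ) : ℝ)]
  have h1 : ν - 1 ≠ 0 := by linarith
  have h2 : 1 - ν ≠ 0 := by linarith
  have h3 : -ν ≠ 0 := by linarith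
  have h4 : ν / (ν - 1) = -ν / (1 - ν) := by
    rw [div_eq_div_iff h1 h2]; ring
  rw [h4]
  have h5 : (((i.deg : ℕ).factorial : ℕ) : ℝ) ≠ 0 := by positivity
  have h6 : ((i.deg : ℕ) : ℝ) ≠ 0 := by exact_mod_cast hm.ne'
  have h7 : (-ν) ^ ((i.deg : ℕ) - 1) ≠ 0 := pow_ne_zero _ h3
  have h8 : ((i.deg : ℕ) : ℝ) ^ ((i.deg : ℕ) - 1) ≠ 0 := pow_ne_zero _ h6
  generalize (-ν) ^ ((i.deg : ℕ) - 1) = A at *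
  generalize ((i.deg : ℕ) : ℝ) ^ ((i.deg : ℕ) - 1) = B at *
  generalize -ν = μ at *
  generalize 1 - ν = κ at *
  field_simp

end BalkingPS

end

theorem theorem2p6 (ρ : ℝ) (hρ : 0 < ρ) :
    (∀ n : ℕ, DifferentiableOn ℝ (BalkingPS.survival ρ n) (Set.Ici 0)) ∧
    ∀ t : ℝ, 0 ≤ t →
      Summable (fun n : ℕ => BalkingPS.mixTerm ρ t n) ∧
      Summable (fun m : ℕ+ => BalkingPS.spectralTerm ρ t m (BalkingPS.eigPlus ρ m)) ∧
      Summable (fun m : ℕ+ => BalkingPS.spectralTerm ρ t m (BalkingPS.eigMinus ρ m)) ∧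
      BalkingPS.uncondDensity ρ t =
        (∑' m : ℕ+, BalkingPS.spectralTerm ρ t m (BalkingPS.eigPlus ρ m)) +
          (∑' m : ℕ+, BalkingPS.spectralTerm ρ t m (BalkingPS.eigMinus ρ m)) := by
  refine ⟨fun n t ht =>
    (BalkingPS.hasDerivWithinAt_survival hρ n ht).differentiableWithinAt, fun t ht => ?_⟩
  set F : BalkingPS.SpecIndex → ℝ := fun i =>
    BalkingPS.spectralTerm ρ t i.deg (BalkingPS.eigenvalue ρ i) with hF
  have h : HasSum F (BalkingPS.uncondDensity ρ t) := BalkingPS.hasSum_spectralTerm hρ ht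
  have hl : F ∘ Sum.inl =
      fun m : ℕ+ => BalkingPS.spectralTerm ρ t m (BalkingPS.eigPlus ρ m) := rfl
  have hr : F ∘ Sum.inr =
      fun m : ℕ+ => BalkingPS.spectralTerm ρ t m (BalkingPS.eigMinus ρ m) := rfl
  rw [← hl, ← hr]
  have hp : Summable (F ∘ Sum.inl) := h.summable.comp_injective Sum.inl_injective
  have hm : Summable (F ∘ Sum.inr) := h.summable.comp_injective Sum.inr_injective
  have hsum : BalkingPS.uncondDensity ρ t = ∑' m, (F ∘ Sum.inl) m + ∑' m, (F ∘ Sum.inr) m :=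
    h.unique (HasSum.sum hp.hasSum hm.hasSum)
  exact ⟨BalkingPS.summable_mixTerm hρ ht, hp, hm, hsum⟩
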